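/- Let $n\ge 1$ and let $C\subset\mathbb{R}^n$ be a closed convex cone with nonempty interior and $C\cap(-C)=\{o\}$. Let $C^\circ=\{x : \langle x,y\rangle\le 0\ \forall y\in C\}$ and $\Omega_{C^\circ}=\operatorname{int}C^\circ\cap\mathbb{S}^{n-1}$. A $C$-pseudo-cone is a nonempty closed convex set $E\subset C$ with $o\notin E$, with $\lambda x\in E$ for all $\lambda\ge1$ and $x\in E$, and with recession cone $\{x: E+x\subset E\}$ equal to $C$. Put $h_E(v)=\sup\{\langle x,v\rangle : x\in E\}$ and $\overline h_E=-h_E$ on $\Omega_{C^\circ}$. The Gaussian co-volume of $E$ is $$\overline\gamma_n(E)=\frac{1}{(2\pi)^{n/2}}\int_{C\setminus E}e^{-|x|^2/2}\,dx,$$ and the Gaussian surface area measure of $E$ is $$S_{\gamma_n}(E,\eta)=\frac1{(2\pi)^{n/2}}\int_{\boldsymbol\nu_E^*(\eta)}e^{-|x|^2/2}\,d\mathcal H^{n-1}(x),\qquad \eta\subset\Omega_{C^\circ}\ \text{Borel},$$ where $\boldsymbol\nu_E^*(\eta)=\{x\in\partial E\cap\operatorname{int}C : \langle x,v\rangle=h_E(v)\text{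 for some }v\in\eta\}$. Let $\omega\subset\Omega_{C^\circ}$ be nonempty and compact, let $K$ be a $C$-pseudo-cone that is $C$-determined by $\omega$, i.e. $K=C\cap\bigcap_{v\in\omega}\{x:\langle x,v\rangle\le h_K(v)\}$, and let $f:\omega\to\mathbb{R}$ be continuous. Then $\overline h_K|_\omega+tf$ is positive on $\omega$ for all sufficiently small $|t|$, $S_{\gamma_n}(K,\cdot)$ is a Borel measure on $\Omega_{C^\circ}$, $f$ is integrable on $\omega$ with respect to it, and $$\lim_{t\to0}\frac{\overline\gamma_n([\overline h_K|_\omega+tf])-\overline\gamma_n(K)}{t}=\int_\omega f(v)\,dS_{\gamma_n}(K,v),$$ where $[g]=C\cap\bigcap_{v\in\omega}\{x:\langle x,v\rangle\le-g(v)\}$ denotes the Wulff shape of a positive continuous function $g$ on $\omega$. -/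

import Mathlib

open MeasureTheory Set Filter Topology
open scoped ENNReal RealInnerProductSpace

namespace PseudoCone

variable {n : ℕ}

/-- The polar cone `C° = {x | ⟨x, y⟩ ≤ 0 for all y ∈ C}`. -/
def polarCone (C : Set (EuclideanSpace ℝ (Fin n))) : Set (EuclideanSpace ℝ (Fin n)) :=
  {x | ∀ y ∈ C, ⟪x, y⟫ ≤ 0}

/-- `Ω_{C°}`, the unit vectors in the interior of the polar cone of `C`. -/
def polarOmega (C : Set (EuclideanSpace ℝ (Fin n))) : Set (EuclideanSpace ℝ (Fin n)) :=
  interior (polarCone C) ∩ Metric.sphere 0 1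

/-- The recession cone `rec E = {x | E + x ⊆ E}`. -/
def recessionCone (E : Set (EuclideanSpace ℝ (Fin n))) : Set (EuclideanSpace ℝ (Fin n)) :=
  {x | ∀ y ∈ E, y + x ∈ E}

/-- `E` is a `C`-pseudo-cone: a nonempty closed convex subset of `C` not containing the origin,
stable under multiplication by scalars `≥ 1`, whose recession cone is `C`. -/
structure IsCPseudoCone (C E : Set (EuclideanSpace ℝ (Fin n))) : Prop where
  subset : E ⊆ C
  nonempty : E.Nonempty
  isClosed : IsClosed E
  convex : Convex ℝ E
  zero_notMem : (0 : EuclideanSpace ℝ (Fin n)) ∉ E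
  smul_mem : ∀ c : ℝ, 1 ≤ c → ∀ x ∈ E, c • x ∈ E
  recessionCone_eq : recessionCone E = C

/-- The support function `h_E(v) = sup {⟨x, v⟩ | x ∈ E}`. For a `C`-pseudo-cone `E` and
`v ∈ Ω_{C°}` the supremum is over a nonempty set of negative numbers. -/
noncomputable def supportFun (E : Set (EuclideanSpace ℝ (Fin n)))
    (v : EuclideanSpace ℝ (Fin n)) : ℝ :=
  sSup ((fun x => ⟪x, v⟫) '' E)

/-- `h̄_E = -h_E`. -/
noncomputable def supportFunBar (E : Set (EuclideanSpace ℝ (Fin n)))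
    (v : EuclideanSpace ℝ (Fin n)) : ℝ :=
  -supportFun E v

/-- `K ∈ 𝒦(C, ω)`: `K` is a `C`-pseudo-cone that is `C`-determined by `ω`, that is,
`K = C ∩ ⋂_{v ∈ ω} H⁻(v, h_K(v))`. -/
def IsDetermined (C ω K : Set (EuclideanSpace ℝ (Fin n))) : Prop :=
  IsCPseudoCone C K ∧ K = C ∩ ⋂ v ∈ ω, {x | ⟪x, v⟫ ≤ supportFun K v}

/-- The Wulff shape `[g] = C ∩ ⋂_{v ∈ ω} {x | ⟨x, v⟩ ≤ -g(v)}`; only the values of `g` on `ω`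
matter. -/
def wulffShape (C ω : Set (EuclideanSpace ℝ (Fin n))) (g : EuclideanSpace ℝ (Fin n) → ℝ) :
    Set (EuclideanSpace ℝ (Fin n)) :=
  C ∩ ⋂ v ∈ ω, {x | ⟪x, v⟫ ≤ -g v}

/-- The inverse Gauss image `ν*_E(η)`: the points of `∂E ∩ int C` at which some `v ∈ η` is an
outer normal vector of `E`. -/
def inverseGaussImage (C E η : Set (EuclideanSpace ℝ (Fin n))) :
    Set (EuclideanSpace ℝ (Fin n)) :=
  {x | x ∈ frontier E ∩ interior C ∧ ∃ v ∈ η, ⟪x, v⟫ = supportFun E v}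

/-- The set function
`S_{γ_n}(E, η) = (2π)^{-n/2} ∫_{ν*_E(η)} exp(-|x|²/2) dℋ^{n-1}(x)`, where `μHE[n - 1]` is
the Hausdorff measure with its Euclidean normalization. -/
noncomputable def gaussianSurfaceArea (C E η : Set (EuclideanSpace ℝ (Fin n))) : ℝ≥0∞ :=
  ENNReal.ofReal (((2 * Real.pi) ^ ((n : ℝ) / 2))⁻¹) *
    ∫⁻ x in inverseGaussImage C E η, ENNReal.ofReal (Real.exp (-‖x‖ ^ 2 / 2)) ∂μHE[n - 1]

/-- `S` is the Gaussian surface area measure `S_{γ_n}(E, ·)`: the Borel measure carried by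
`Ω_{C°}` with value `gaussianSurfaceArea C E η` at each Borel set `η ⊆ Ω_{C°}`. There is at most
one such measure, see `IsGaussianSurfaceAreaMeasure.unique`. -/
def IsGaussianSurfaceAreaMeasure (C E : Set (EuclideanSpace ℝ (Fin n)))
    (S : Measure (EuclideanSpace ℝ (Fin n))) : Prop :=
  S (polarOmega C)ᶜ = 0 ∧
    ∀ η : Set (EuclideanSpace ℝ (Fin n)), MeasurableSet η → η ⊆ polarOmega C →
      S η = gaussianSurfaceArea C E η

theorem IsGaussianSurfaceAreaMeasure.unique {C E : Set (EuclideanSpace ℝ (Fin n))}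
    {S T : Measure (EuclideanSpace ℝ (Fin n))} (hS : IsGaussianSurfaceAreaMeasure C E S)
    (hT : IsGaussianSurfaceAreaMeasure C E T) : S = T := by
  have hm : MeasurableSet (polarOmega C) :=
    isOpen_interior.measurableSet.inter Metric.isClosed_sphere.measurableSet
  ext η hη
  rw [← measure_inter_conull hS.1, ← measure_inter_conull hT.1,
    hS.2 _ (hη.inter hm) inter_subset_right, hT.2 _ (hη.inter hm) inter_subset_right]

/-- The Gaussian co-volume `γ̄_n(E) = (2π)^{-n/2} ∫_{C \ E} exp(-|x|²/2) dx`. -/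
noncomputable def gaussianCovolume (C E : Set (EuclideanSpace ℝ (Fin n))) : ℝ :=
  ((2 * Real.pi) ^ ((n : ℝ) / 2))⁻¹ * ∫ x in C \ E, Real.exp (-‖x‖ ^ 2 / 2)

end PseudoCone

/-! Fix a unit vector `u` in the interior of `C`. Over `u^⊥`, in direction `u`, the cone is the
epigraph of `coneHeight`, and the Wulff shape of `h̄_K + t f` is the epigraph of `epiHeight`: the
maximum of `coneHeight` and a supremum over `ω` of functions affine in the base point and in `t`.
The co-volume is then an integral over `u^⊥` of one-dimensional Gaussian integrals between the two
heights, and the theorem becomes differentiation under the integral sign (`hasDerivAt_integral`).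
Compactness of `ω` makes the heights Lipschitz in `t` uniformly in the base point, which gives the
domination.

The pointwise derivative exists wherever the height at `t = 0` is differentiable, hence almost
everywhere by Rademacher. At such a point above the cone boundary, every maximizing `v` is an outer
normal, and differentiability leaves only one, so Danskin's theorem gives `f v / (-⟪v, u⟫)`. The two
branches of the maximum cannot meet there (`coneHeight_ne_wulffHeight`): homogeneity of the cone
would force the tangent hyperplane through the origin, against `h̄_K > 0`.

The derivative is an integral of `f` against an image measure under the Gauss normal `N`. It agrees
with the Hausdorff definition by the area formula with density `|⟪N, u⟫|⁻¹` (`area_graphMap`),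
proved by flattening pieces on which `N` varies little. -/

namespace PseudoCone

open scoped NNReal

/-! ### Area formula for graphs with supporting normals -/

section Area

variable {E : Type*} [NormedAddCommGroup E] [InnerProductSpace ℝ E]

/-- The parametrization `y ↦ y + φ(y) u` of the graph of `φ` over the hyperplane `u^⊥`. -/
def graphMap (u : E) (φ : (ℝ ∙ u)ᗮ → ℝ) (y : (ℝ ∙ u)ᗮ) : E := (y : E) + φ y • u

theorem inner_coe_orthogonal (u : E) (y : (ℝ ∙ u)ᗮ) : ⟪(y : E), u⟫ = 0 := by
  rw [real_inner_comm]
  exact Submodule.mem_orthogonal_singleton_iff_inner_right.1 y.2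

/-- The projection of `u^⊥` along `u` onto the hyperplane `v^⊥`. -/
noncomputable def shear (u v : E) : (ℝ ∙ u)ᗮ →ₗ[ℝ] E :=
  (ℝ ∙ u)ᗮ.subtype - ((⟪v, u⟫⁻¹ • (innerₗ E v)).comp (ℝ ∙ u)ᗮ.subtype).smulRight u

theorem shear_apply (u v : E) (y : (ℝ ∙ u)ᗮ) :
    shear u v y = (y : E) - (⟪v, u⟫⁻¹ * ⟪v, (y : E)⟫) • u := rfl

theorem continuous_graphMap (u : E) {φ : (ℝ ∙ u)ᗮ → ℝ} (hφ : Continuous φ) :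
    Continuous (graphMap u φ) := by
  unfold graphMap
  fun_prop

theorem orthogonalProjectionOnto_graphMap (u : E) (φ : (ℝ ∙ u)ᗮ → ℝ) (y : (ℝ ∙ u)ᗮ) :
    (ℝ ∙ u)ᗮ.orthogonalProjectionOnto (graphMap u φ y) = y := by
  rw [graphMap, map_add, Submodule.orthogonalProjectionOnto_mem_subspace_eq_self, map_smul,
    Submodule.orthogonalProjectionOnto_orthogonal_apply_eq_zero
      (Submodule.mem_span_singleton_self u), smul_zero, add_zero]

theorem isClosedEmbedding_graphMap (u : E) {φ : (ℝ ∙ u)ᗮ → ℝ} (hφ : Continuous φ) :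
    IsClosedEmbedding (graphMap u φ) :=
  Function.LeftInverse.isClosedEmbedding (orthogonalProjectionOnto_graphMap u φ)
    (ContinuousLinearMap.continuous _) (continuous_graphMap u hφ)

variable [FiniteDimensional ℝ E]

/-- With `b = ⟪v, u⟫` and `p` the projection of `v` to `u^⊥`, the Gram operator of the shear is the
identity plus the rank-one map `b⁻² ⟪p, ·⟫ p`. Since `‖p‖² = 1 - b²`, its determinant is `1 + b⁻² (1
- b²) = b⁻²`. -/
theorem normDet_shear {u v : E} (hu : ‖u‖ = 1) (hv : ‖v‖ = 1) (huv : ⟪v, u⟫ ≠ 0) :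
    (shear u v).normDet = |⟪v, u⟫|⁻¹ := by
  set b := ⟪v, u⟫ with hb
  set p : (ℝ ∙ u)ᗮ := (ℝ ∙ u)ᗮ.orthogonalProjectionOnto v with hp
  have hpv : ∀ y : (ℝ ∙ u)ᗮ, ⟪v, (y : E)⟫ = ⟪p, y⟫ := by
    intro y
    rw [hp, Submodule.inner_orthogonalProjectionOnto_eq_of_mem_right]
  have hpe : (p : E) = v - b • u := by
    have h1 : (ℝ ∙ u).starProjection v = ⟪u, v⟫ • u := Submodule.starProjection_unit_singleton ℝ hu v
    have h2 := Submodule.starProjection_add_starProjection_orthogonal (K := ℝ ∙ u) v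
    rw [h1, real_inner_comm, ← hb] at h2
    rw [hp]
    exact eq_sub_of_add_eq' h2
  have hpn : ⟪p, p⟫ = 1 - b ^ 2 := by
    rw [← hpv, hpe, inner_sub_right, real_inner_smul_right, ← hb, real_inner_self_eq_norm_sq, hv]
    ring
  have hsq := LinearMap.normDet_sq (shear u v)
  have hadj : (shear u v).adjoint ∘ₗ shear u v
      = LinearMap.transvection ((b⁻¹ ^ 2) • innerₗ _ p) p := by
    refine LinearMap.ext fun y => ext_inner_right ℝ fun z => ?_
    rw [LinearMap.comp_apply, LinearMap.adjoint_inner_left, LinearMap.transvection.apply,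
      shear_apply, shear_apply, inner_add_left, real_inner_smul_left]
    simp only [LinearMap.smul_apply, innerₗ_apply_apply, smul_eq_mul]
    rw [inner_sub_left, inner_sub_right, inner_sub_right, real_inner_smul_left,
      real_inner_smul_right, real_inner_smul_right, real_inner_smul_left,
      real_inner_self_eq_norm_sq, hu, inner_coe_orthogonal, real_inner_comm (z : E) u,
      inner_coe_orthogonal, hpv, hpv, ← Submodule.coe_inner]
    ring
  rw [hadj, LinearMap.transvection.det] at hsq
  simp only [LinearMap.smul_apply, innerₗ_apply_apply, smul_eq_mul, hpn] at hsq
  have : (shear u v).normDet ^ 2 = (|b|⁻¹) ^ 2 := by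
    rw [inv_pow, sq_abs]
    have hsq' : (shear u v).normDet ^ 2 = 1 + b⁻¹ ^ 2 * (1 - b ^ 2) := hsq
    rw [hsq']
    field_simp
    ring
  exact (sq_eq_sq₀ (LinearMap.normDet_nonneg _) (by positivity)).1 this

variable [MeasurableSpace E] [BorelSpace E]

theorem _root_.LipschitzOnWith.euclideanHausdorffMeasure_image_le {X Y : Type*} [EMetricSpace X]
    [MeasurableSpace X] [BorelSpace X] [EMetricSpace Y] [MeasurableSpace Y] [BorelSpace Y]
    {k : ℝ≥0} {g : X → Y} {s : Set X} (h : LipschitzOnWith k g s) (d : ℕ) :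
    μHE[d] (g '' s) ≤ (k : ℝ≥0∞) ^ d * μHE[d] s := by
  simp_rw [Measure.euclideanHausdorffMeasure_def, Measure.smul_apply, Measure.nnreal_smul_coe_apply]
  rw [mul_left_comm]
  gcongr
  simpa using h.hausdorffMeasure_image_le (d := d) (by positivity)

/-- Area of a piece of graph along which the oblique projection `u^⊥ → v^⊥` is almost isometric. -/
theorem area_almost_flat {u v : E} (hu : ‖u‖ = 1) (hv : ‖v‖ = 1) (huv : ⟪v, u⟫ ≠ 0)
    {φ : (ℝ ∙ u)ᗮ → ℝ} {A : Set (ℝ ∙ u)ᗮ} {κ : ℝ} (hκ0 : 0 ≤ κ) (hκ1 : κ < 1)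
    (hA : ∀ y ∈ A, ∀ z ∈ A, |⟪v, graphMap u φ y - graphMap u φ z⟫|
      ≤ κ * |⟪v, u⟫| * ‖graphMap u φ y - graphMap u φ z‖) :
    μHE[Module.finrank ℝ (ℝ ∙ u)ᗮ] (graphMap u φ '' A)
        ≤ ENNReal.ofReal (1 - κ)⁻¹ ^ Module.finrank ℝ (ℝ ∙ u)ᗮ *
          (ENNReal.ofReal |⟪v, u⟫|⁻¹ * volume A) ∧
      ENNReal.ofReal |⟪v, u⟫|⁻¹ * volume A ≤
        ENNReal.ofReal (1 + κ) ^ Module.finrank ℝ (ℝ ∙ u)ᗮ *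
          μHE[Module.finrank ℝ (ℝ ∙ u)ᗮ] (graphMap u φ '' A) := by
  set Q : E → E := fun x => x - (⟪v, u⟫⁻¹ * ⟪v, x⟫) • u with hQ
  have hQG : ∀ y, Q (graphMap u φ y) = shear u v y := by
    intro y
    simp only [hQ, graphMap, shear_apply, inner_add_right, real_inner_smul_right]
    have : ⟪v, u⟫⁻¹ * (⟪v, (y : E)⟫ + φ y * ⟪v, u⟫) = ⟪v, u⟫⁻¹ * ⟪v, (y : E)⟫ + φ y := by
      field_simp
    rw [this, add_smul]
    abel
  -- `Q` projects onto `v^⊥` along `u`. What it removes from a chord is a multiple of `u` controlled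
  -- by `hA`, so chords change by a relative error of at most `κ`.
  have hdiff : ∀ y ∈ A, ∀ z ∈ A, ‖(graphMap u φ y - graphMap u φ z)
      - (shear u v y - shear u v z)‖ ≤ κ * ‖graphMap u φ y - graphMap u φ z‖ := by
    intro y hy z hz
    have h1 : (graphMap u φ y - graphMap u φ z) - (shear u v y - shear u v z)
        = (⟪v, u⟫⁻¹ * ⟪v, graphMap u φ y - graphMap u φ z⟫) • u := by
      rw [← hQG, ← hQG]
      simp only [hQ, inner_sub_right, mul_sub, sub_smul]
      abel
    rw [h1, norm_smul, hu, mul_one, Real.norm_eq_abs, abs_mul, abs_inv]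
    have := hA y hy z hz
    have hpos : 0 < |⟪v, u⟫| := abs_pos.2 huv
    rw [inv_mul_le_iff₀ hpos]
    linarith
  have hvol : μHE[Module.finrank ℝ (ℝ ∙ u)ᗮ] (shear u v '' A)
      = ENNReal.ofReal |⟪v, u⟫|⁻¹ * volume A := by
    rw [LinearMap.euclideanHausdorffMeasure_image_eq_normDet_mul_volume, normDet_shear hu hv huv]
  rw [← hvol]
  have hproj : ∀ y, (ℝ ∙ u)ᗮ.orthogonalProjectionOnto (shear u v y) = y := by
    intro y
    rw [shear_apply, map_sub, Submodule.orthogonalProjectionOnto_mem_subspace_eq_self, map_smul,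
      Submodule.orthogonalProjectionOnto_orthogonal_apply_eq_zero
        (Submodule.mem_span_singleton_self u), smul_zero, sub_zero]
  constructor
  -- The inverse of `Q` on the piece: project to `u^⊥`, then lift back to the graph.
  · have hlip : LipschitzOnWith (Real.toNNReal (1 - κ)⁻¹)
        (fun x => graphMap u φ ((ℝ ∙ u)ᗮ.orthogonalProjectionOnto x)) (shear u v '' A) := by
      refine LipschitzOnWith.of_dist_le_mul ?_
      rintro _ ⟨y, hy, rfl⟩ _ ⟨z, hz, rfl⟩
      rw [hproj, hproj, dist_eq_norm, dist_eq_norm,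
        Real.coe_toNNReal _ (inv_nonneg.2 (by linarith)), le_inv_mul_iff₀ (by linarith)]
      have h1 := hdiff y hy z hz
      have h2 := norm_sub_norm_le (graphMap u φ y - graphMap u φ z) (shear u v y - shear u v z)
      linarith
    have := hlip.euclideanHausdorffMeasure_image_le (Module.finrank ℝ (ℝ ∙ u)ᗮ)
    rw [image_image] at this
    simp only [hproj] at this
    exact this
  · have hlip : LipschitzOnWith (Real.toNNReal (1 + κ)) Q (graphMap u φ '' A) := by
      refine LipschitzOnWith.of_dist_le_mul ?_
      rintro _ ⟨y, hy, rfl⟩ _ ⟨z, hz, rfl⟩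
      rw [hQG, hQG, dist_eq_norm, dist_eq_norm, Real.coe_toNNReal _ (by linarith)]
      have h1 := hdiff y hy z hz
      have h2 := norm_sub_norm_le (shear u v y - shear u v z) (graphMap u φ y - graphMap u φ z)
      rw [norm_sub_rev (shear u v y - shear u v z)] at h2
      linarith
    have := hlip.euclideanHausdorffMeasure_image_le (Module.finrank ℝ (ℝ ∙ u)ᗮ)
    rw [image_image] at this
    simp only [hQG] at this
    exact this

/-- Two comparable measures of all small pieces are comparable on the whole set. -/
theorem measure_le_of_small_pieces {X Y : Type*} [MeasurableSpace X] [MetricSpace Y]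
    [TopologicalSpace.SeparableSpace Y] [MeasurableSpace Y] [BorelSpace Y] {μ ν : Measure X}
    {g : X → Y} (hg : Measurable g) {r : ℝ} (hr : 0 < r) {A : Set X} (hA : MeasurableSet A)
    (h : ∀ B ⊆ A, MeasurableSet B → (∀ x ∈ B, ∀ y ∈ B, dist (g x) (g y) ≤ r) → μ B ≤ ν B) :
    μ A ≤ ν A := by
  rcases isEmpty_or_nonempty Y with hY | hY
  · have : IsEmpty X := ⟨fun x => hY.elim (g x)⟩
    simp [Set.eq_empty_of_isEmpty A]
  -- Balls of radius `r / 2` have diameter at most `r`; disjointing them cuts `A` into countably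
  -- many admissible pieces.
  set U : ℕ → Set Y := fun i => Metric.ball (TopologicalSpace.denseSeq Y i) (r / 2) with hU
  have hUm : ∀ i, MeasurableSet (disjointed U i) := fun i =>
    MeasurableSet.disjointed (fun i => Metric.isOpen_ball.measurableSet) i
  have hcov : (⋃ i, disjointed U i) = univ := by
    rw [iUnion_disjointed, eq_univ_iff_forall]
    intro y
    obtain ⟨i, hi⟩ := (TopologicalSpace.denseRange_denseSeq Y).exists_dist_lt y (half_pos hr)
    exact mem_iUnion.2 ⟨i, hi⟩
  have hAe : A = ⋃ i, A ∩ g ⁻¹' disjointed U i := by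
    rw [← inter_iUnion, ← preimage_iUnion, hcov, preimage_univ, inter_univ]
  have hm : ∀ i, MeasurableSet (A ∩ g ⁻¹' disjointed U i) := fun i => hA.inter (hg (hUm i))
  have hd : Pairwise (Function.onFun Disjoint fun i => A ∩ g ⁻¹' disjointed U i) := fun i j hij =>
    ((disjoint_disjointed U hij).preimage g).mono inter_subset_right inter_subset_right
  rw [hAe, measure_iUnion hd hm, measure_iUnion hd hm]
  refine ENNReal.tsum_le_tsum fun i => h _ inter_subset_left (hm i) ?_
  rintro x ⟨-, hx⟩ y ⟨-, hy⟩
  have h1 := disjointed_subset U i hx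
  have h2 := disjointed_subset U i hy
  simp only [hU, Metric.mem_ball] at h1 h2
  have := dist_triangle_right (g x) (g y) (TopologicalSpace.denseSeq Y i)
  linarith

/-- Freeze the normal at one point `y₀`. The other normals differ from it by at most `κ c`, so the
piece is flat up to `κ` relative to `N y₀`, and replacing the density by its value at `y₀` costs a
factor of at most `1 + κ`. -/
theorem area_bounds_of_small {u : E} (hu : ‖u‖ = 1) {φ : (ℝ ∙ u)ᗮ → ℝ} {N : (ℝ ∙ u)ᗮ → E}
    {B : Set (ℝ ∙ u)ᗮ} (hB : MeasurableSet B) {c κ : ℝ} (hc : 0 < c)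
    (hκ0 : 0 < κ) (hκ1 : κ < 1) (hNB : ∀ y ∈ B, ‖N y‖ = 1) (hcB : ∀ y ∈ B, c ≤ |⟪N y, u⟫|)
    (hnormal : ∀ y ∈ B, ∀ z ∈ B, ⟪N y, graphMap u φ z - graphMap u φ y⟫ ≤ 0)
    (hsmall : ∀ y ∈ B, ∀ z ∈ B, dist (N y) (N z) ≤ κ * c) :
    μHE[Module.finrank ℝ (ℝ ∙ u)ᗮ] (graphMap u φ '' B)
        ≤ ENNReal.ofReal (1 - κ)⁻¹ ^ Module.finrank ℝ (ℝ ∙ u)ᗮ * (ENNReal.ofReal (1 + κ) *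
          ∫⁻ y in B, ENNReal.ofReal |⟪N y, u⟫|⁻¹) ∧
      ∫⁻ y in B, ENNReal.ofReal |⟪N y, u⟫|⁻¹ ≤
        ENNReal.ofReal (1 + κ) * (ENNReal.ofReal (1 + κ) ^ Module.finrank ℝ (ℝ ∙ u)ᗮ *
          μHE[Module.finrank ℝ (ℝ ∙ u)ᗮ] (graphMap u φ '' B)) := by
  rcases B.eq_empty_or_nonempty with rfl | ⟨y₀, hy₀⟩
  · simp
  have hb0 := hcB y₀ hy₀
  have hpos : 0 < |⟪N y₀, u⟫| := hc.trans_le hb0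
  have hdist : ∀ y ∈ B, |⟪N y, u⟫ - ⟪N y₀, u⟫| ≤ κ * c := by
    intro y hy
    rw [← inner_sub_left]
    refine (abs_real_inner_le_norm _ _).trans ?_
    rw [hu, mul_one, ← dist_eq_norm]
    exact hsmall y hy y₀ hy₀
  have hflat := area_almost_flat hu (hNB y₀ hy₀) (abs_pos.1 hpos) (φ := φ) (A := B) hκ0.le hκ1 ?_
  · constructor
    · refine hflat.1.trans ?_
      refine mul_le_mul_right ?_ _
      rw [← lintegral_const_mul' _ _ ENNReal.ofReal_ne_top, ← setLIntegral_const]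
      refine setLIntegral_mono' hB fun y hy => ?_
      rw [← ENNReal.ofReal_mul (by linarith)]
      refine ENNReal.ofReal_le_ofReal ?_
      have h1 := abs_sub_abs_le_abs_sub ⟪N y, u⟫ ⟪N y₀, u⟫
      have h2 := hdist y hy
      have h3 : 0 < |⟪N y, u⟫| := hc.trans_le (hcB y hy)
      rw [inv_le_iff_one_le_mul₀ hpos, mul_right_comm, ← div_eq_mul_inv, le_div_iff₀ h3, one_mul]
      nlinarith
    · refine le_trans ?_ (mul_le_mul_right hflat.2 _)
      rw [← setLIntegral_const, ← lintegral_const_mul' _ _ ENNReal.ofReal_ne_top]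
      refine setLIntegral_mono' hB fun y hy => ?_
      rw [← ENNReal.ofReal_mul (by linarith)]
      refine ENNReal.ofReal_le_ofReal ?_
      have h1 := abs_sub_abs_le_abs_sub ⟪N y₀, u⟫ ⟪N y, u⟫
      rw [abs_sub_comm ⟪N y₀, u⟫] at h1
      have h2 := hdist y hy
      have hcy := hcB y hy
      have h3 : 0 < |⟪N y, u⟫| := hc.trans_le hcy
      rw [inv_le_iff_one_le_mul₀ h3, mul_right_comm, ← div_eq_mul_inv, le_div_iff₀ hpos, one_mul]
      nlinarith
  · intro y hy z hz
    -- The normal at `y` bounds the `N y₀`-component of a chord from above; exchanging the endpoints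
    -- gives the lower bound.
    have key : ∀ y ∈ B, ∀ z ∈ B, ⟪N y₀, graphMap u φ z - graphMap u φ y⟫
        ≤ κ * |⟪N y₀, u⟫| * ‖graphMap u φ z - graphMap u φ y‖ := by
      intro y hy z hz
      have h1 := hnormal y hy z hz
      have h2 : ⟪N y₀ - N y, graphMap u φ z - graphMap u φ y⟫
          ≤ κ * c * ‖graphMap u φ z - graphMap u φ y‖ := by
        refine (real_inner_le_norm _ _).trans ?_
        gcongr
        rw [← dist_eq_norm]
        exact hsmall y₀ hy₀ y hy
      rw [inner_sub_left] at h2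
      have h3 : κ * c * ‖graphMap u φ z - graphMap u φ y‖
          ≤ κ * |⟪N y₀, u⟫| * ‖graphMap u φ z - graphMap u φ y‖ := by gcongr
      linarith
    rw [abs_le]
    constructor
    · have := key y hy z hz
      rw [← neg_sub (graphMap u φ y), inner_neg_right, norm_neg] at this
      linarith
    · exact key z hz y hy

/-- The area formula for the graph of a function, in terms of unit normal vectors which support the
part of the graph considered. -/
theorem area_graphMap {u : E} (hu : ‖u‖ = 1) {φ : (ℝ ∙ u)ᗮ → ℝ} (hφ : Continuous φ)
    {N : (ℝ ∙ u)ᗮ → E} (hN : Measurable N) {A : Set (ℝ ∙ u)ᗮ} (hA : MeasurableSet A) {c : ℝ}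
    (hc : 0 < c) (hNA : ∀ y ∈ A, ‖N y‖ = 1) (hcA : ∀ y ∈ A, c ≤ |⟪N y, u⟫|)
    (hnormal : ∀ y ∈ A, ∀ z ∈ A, ⟪N y, graphMap u φ z - graphMap u φ y⟫ ≤ 0) :
    μHE[Module.finrank ℝ (ℝ ∙ u)ᗮ] (graphMap u φ '' A) =
      ∫⁻ y in A, ENNReal.ofReal |⟪N y, u⟫|⁻¹ := by
  set d := Module.finrank ℝ (ℝ ∙ u)ᗮ with hd
  have hemb := (isClosedEmbedding_graphMap u hφ).measurableEmbedding
  set μ : Measure (ℝ ∙ u)ᗮ := (μHE[d] : Measure E).comap (graphMap u φ) with hμ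
  set ν : Measure (ℝ ∙ u)ᗮ := volume.withDensity fun y => ENNReal.ofReal |⟪N y, u⟫|⁻¹ with hν
  have hμB : ∀ B, μ B = μHE[d] (graphMap u φ '' B) := fun B => hemb.comap_apply _ B
  have hνB : ∀ B, MeasurableSet B → ν B = ∫⁻ y in B, ENNReal.ofReal |⟪N y, u⟫|⁻¹ :=
    fun B hB => withDensity_apply _ hB
  rw [← hμB, ← hνB A hA]
  -- The pieces are those on which the normal `N` varies by at most `κ c`. Both comparison factors
  -- tend to `1` as `κ → 0`.
  have hloc : ∀ κ ∈ Ioo (0 : ℝ) 1,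
      μ A ≤ ENNReal.ofReal (1 - κ)⁻¹ ^ d * ENNReal.ofReal (1 + κ) * ν A ∧
      ν A ≤ ENNReal.ofReal (1 + κ) * ENNReal.ofReal (1 + κ) ^ d * μ A := by
    rintro κ ⟨hκ0, hκ1⟩
    have hr : 0 < κ * c := mul_pos hκ0 hc
    constructor
    · refine measure_le_of_small_pieces (μ := μ)
        (ν := (ENNReal.ofReal (1 - κ)⁻¹ ^ d * ENNReal.ofReal (1 + κ)) • ν) hN hr hA ?_
      intro B hBA hB hsmall
      rw [Measure.smul_apply, smul_eq_mul, hμB, hνB B hB, mul_assoc]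
      exact (area_bounds_of_small hu hB hc hκ0 hκ1 (fun y hy => hNA y (hBA hy))
        (fun y hy => hcA y (hBA hy)) (fun y hy z hz => hnormal y (hBA hy) z (hBA hz)) hsmall).1
    · refine measure_le_of_small_pieces (μ := ν)
        (ν := (ENNReal.ofReal (1 + κ) * ENNReal.ofReal (1 + κ) ^ d) • μ) hN hr hA ?_
      intro B hBA hB hsmall
      rw [Measure.smul_apply, smul_eq_mul, hμB, hνB B hB, mul_assoc]
      exact (area_bounds_of_small hu hB hc hκ0 hκ1 (fun y hy => hNA y (hBA hy))
        (fun y hy => hcA y (hBA hy)) (fun y hy z hz => hnormal y (hBA hy) z (hBA hz)) hsmall).2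
  have hev : ∀ᶠ κ in 𝓝[>] (0 : ℝ), κ ∈ Ioo (0 : ℝ) 1 := Ioo_mem_nhdsGT one_pos
  have t1 : Tendsto (fun κ : ℝ => ENNReal.ofReal (1 + κ)) (𝓝[>] 0) (𝓝 1) := by
    have : Tendsto (fun κ : ℝ => ENNReal.ofReal (1 + κ)) (𝓝[>] 0) (𝓝 (ENNReal.ofReal (1 + 0))) :=
      (ENNReal.tendsto_ofReal (by fun_prop : Continuous fun κ : ℝ => 1 + κ).continuousAt).mono_left
        nhdsWithin_le_nhds
    simpa using this
  have t2 : Tendsto (fun κ : ℝ => ENNReal.ofReal (1 - κ)⁻¹) (𝓝[>] 0) (𝓝 1) := by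
    have h0 : ContinuousAt (fun κ : ℝ => (1 - κ)⁻¹) 0 :=
      ContinuousAt.inv₀ (by fun_prop) (by norm_num)
    have := (ENNReal.tendsto_ofReal h0.tendsto).mono_left (nhdsWithin_le_nhds (s := Ioi 0))
    simpa using this
  have t2d : Tendsto (fun κ : ℝ => ENNReal.ofReal (1 - κ)⁻¹ ^ d) (𝓝[>] 0) (𝓝 1) := by
    simpa using ENNReal.Tendsto.pow t2 (n := d)
  have t1d : Tendsto (fun κ : ℝ => ENNReal.ofReal (1 + κ) ^ d) (𝓝[>] 0) (𝓝 1) := by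
    simpa using ENNReal.Tendsto.pow t1 (n := d)
  have t3 := ENNReal.Tendsto.mul t2d (by simp) t1 (by simp)
  have t4 := ENNReal.Tendsto.mul t1 (by simp) t1d (by simp)
  rw [mul_one] at t3 t4
  refine le_antisymm ?_ ?_
  · have := ENNReal.Tendsto.mul_const t3 (b := ν A) (by simp)
    rw [one_mul] at this
    exact ge_of_tendsto this (hev.mono fun κ hκ => (hloc κ hκ).1)
  · have := ENNReal.Tendsto.mul_const t4 (b := μ A) (by simp)
    rw [one_mul] at this
    exact ge_of_tendsto this (hev.mono fun κ hκ => (hloc κ hκ).2)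

/-- Change of variables on a graph, for the Hausdorff measure. -/
theorem setLIntegral_graphMap {u : E} (hu : ‖u‖ = 1) {φ : (ℝ ∙ u)ᗮ → ℝ} (hφ : Continuous φ)
    {N : (ℝ ∙ u)ᗮ → E} (hN : Measurable N) {A : Set (ℝ ∙ u)ᗮ} (hA : MeasurableSet A) {c : ℝ}
    (hc : 0 < c) (hNA : ∀ y ∈ A, ‖N y‖ = 1) (hcA : ∀ y ∈ A, c ≤ |⟪N y, u⟫|)
    (hnormal : ∀ y ∈ A, ∀ z ∈ A, ⟪N y, graphMap u φ z - graphMap u φ y⟫ ≤ 0) {w : E → ℝ≥0∞}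
    (hw : Measurable w) :
    ∫⁻ x in graphMap u φ '' A, w x ∂μHE[Module.finrank ℝ (ℝ ∙ u)ᗮ] =
      ∫⁻ y in A, ENNReal.ofReal |⟪N y, u⟫|⁻¹ * w (graphMap u φ y) := by
  have hemb := (isClosedEmbedding_graphMap u hφ).measurableEmbedding
  have hden : Measurable fun y => ENNReal.ofReal |⟪N y, u⟫|⁻¹ := by fun_prop
  have hmeas : ((μHE[Module.finrank ℝ (ℝ ∙ u)ᗮ] : Measure E).comap (graphMap u φ)).restrict A =
      (volume.restrict A).withDensity fun y => ENNReal.ofReal |⟪N y, u⟫|⁻¹ := by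
    ext B hB
    rw [Measure.restrict_apply hB, hemb.comap_apply, withDensity_apply _ hB,
      Measure.restrict_restrict hB]
    exact area_graphMap hu hφ hN (hB.inter hA) hc (fun y hy => hNA y hy.2)
      (fun y hy => hcA y hy.2) (fun y hy z hz => hnormal y hy.2 z hz.2)
  have hmap : (μHE[Module.finrank ℝ (ℝ ∙ u)ᗮ] : Measure E).restrict (graphMap u φ '' A) =
      (((μHE[Module.finrank ℝ (ℝ ∙ u)ᗮ] : Measure E).comap (graphMap u φ)).restrict A).map
        (graphMap u φ) := by
    rw [hemb.restrict_comap, hemb.map_comap, Measure.restrict_restrict hemb.measurableSet_range,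
      inter_eq_right.2 (image_subset_range _ _)]
  rw [hmap, hmeas, hemb.lintegral_map]
  exact lintegral_withDensity_eq_lintegral_mul _ hden (hw.comp hemb.measurable)

/-- A Lipschitz graph map preserves null sets. This discards the boundary points over which the
height is not differentiable. -/
theorem euclideanHausdorffMeasure_graphMap_null {u : E} (hu : ‖u‖ = 1) {φ : (ℝ ∙ u)ᗮ → ℝ} {k : ℝ≥0}
    (hφ : LipschitzWith k φ) {A : Set (ℝ ∙ u)ᗮ} (hA : volume A = 0) :
    μHE[Module.finrank ℝ (ℝ ∙ u)ᗮ] (graphMap u φ '' A) = 0 := by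
  have hlip : LipschitzWith (1 + k) (graphMap u φ) := by
    refine LipschitzWith.of_dist_le_mul fun y z => ?_
    have h1 : graphMap u φ y - graphMap u φ z = ((y : E) - z) + (φ y - φ z) • u := by
      simp only [graphMap, sub_smul]
      abel
    rw [dist_eq_norm, h1]
    refine (norm_add_le _ _).trans ?_
    rw [norm_smul, hu, mul_one, NNReal.coe_add, NNReal.coe_one, add_mul, one_mul,
      ← dist_eq_norm (φ y)]
    exact add_le_add (dist_eq_norm y z).ge (hφ.dist_le_mul y z)
  have := (hlip.lipschitzOnWith (s := A)).euclideanHausdorffMeasure_image_le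
    (Module.finrank ℝ (ℝ ∙ u)ᗮ)
  rw [InnerProductSpace.euclideanHausdorffMeasure_eq_volume, hA, mul_zero] at this
  exact le_antisymm this bot_le

end Area

/-! ### Gaussian integration along lines parallel to `u` -/

section Slices

variable {E : Type*} [NormedAddCommGroup E] [InnerProductSpace ℝ E]

theorem norm_sq_add_smul {u : E} (hu : ‖u‖ = 1) (y : (ℝ ∙ u)ᗮ) (s : ℝ) :
    ‖(y : E) + s • u‖ ^ 2 = ‖y‖ ^ 2 + s ^ 2 := by
  rw [norm_add_sq_real, real_inner_smul_right, inner_coe_orthogonal, norm_smul, hu,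
    Submodule.coe_norm, Real.norm_eq_abs, mul_one, sq_abs]
  ring

variable [FiniteDimensional ℝ E]

theorem finrank_orthogonal_add_one {u : E} (hu : u ≠ 0) :
    Module.finrank ℝ (ℝ ∙ u)ᗮ + 1 = Module.finrank ℝ E := by
  rw [← Submodule.finrank_add_finrank_orthogonal (ℝ ∙ u), finrank_span_singleton hu, add_comm]

variable [MeasurableSpace E] [BorelSpace E]

/-- The orthogonal decomposition is a linear isometry for the `L²` norm on the product. `WithLp 2`
is needed because the plain product carries the sup norm. -/
theorem measurePreserving_add_smul {u : E} (hu : ‖u‖ = 1) :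
    MeasurePreserving (fun p : (ℝ ∙ u)ᗮ × ℝ => (p.1 : E) + p.2 • u) volume volume ∧
      MeasurableEmbedding (fun p : (ℝ ∙ u)ᗮ × ℝ => (p.1 : E) + p.2 • u) := by
  have hu0 : u ≠ 0 := by
    rintro rfl
    simp at hu
  let L : WithLp 2 ((ℝ ∙ u)ᗮ × ℝ) →ₗ[ℝ] E :=
    { toFun := fun p => (p.fst : E) + p.snd • u
      map_add' := fun p q => by
        simp only [WithLp.add_fst, WithLp.add_snd, Submodule.coe_add, add_smul]
        abel
      map_smul' := fun c p => by
        simp only [WithLp.smul_fst, WithLp.smul_snd, Submodule.coe_smul, smul_add, smul_smul,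
          smul_eq_mul, RingHom.id_apply] }
  let Li : WithLp 2 ((ℝ ∙ u)ᗮ × ℝ) →ₗᵢ[ℝ] E :=
    { L with
      norm_map' := fun p => by
        have : ‖L p‖ ^ 2 = ‖p‖ ^ 2 := by
          rw [WithLp.prod_norm_sq_eq_of_L2, Real.norm_eq_abs, sq_abs]
          exact norm_sq_add_smul hu p.fst p.snd
        exact (sq_eq_sq₀ (norm_nonneg _) (norm_nonneg _)).1 this }
  have hfin : Module.finrank ℝ (WithLp 2 ((ℝ ∙ u)ᗮ × ℝ)) = Module.finrank ℝ E := by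
    rw [(WithLp.linearEquiv 2 ℝ ((ℝ ∙ u)ᗮ × ℝ)).finrank_eq, Module.finrank_prod,
      Module.finrank_self, finrank_orthogonal_add_one hu0]
  let e := Li.toLinearIsometryEquiv hfin
  exact ⟨e.measurePreserving.comp (WithLp.volume_preserving_toLp (ℝ ∙ u)ᗮ ℝ),
    e.toHomeomorph.measurableEmbedding.comp
      (MeasurableEquiv.toLp 2 ((ℝ ∙ u)ᗮ × ℝ)).measurableEmbedding⟩

variable (E) in
theorem integrable_exp_neg_norm_sq_div_two : Integrable (fun v : E => Real.exp (-‖v‖ ^ 2 / 2)) := by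
  have := (GaussianFourier.integrable_cexp_neg_mul_sq_norm_add (V := E) (b := 1 / 2)
    (by norm_num) 0 0).norm
  refine this.congr (Eventually.of_forall fun v => ?_)
  simp [Complex.norm_exp]
  norm_cast
  ring

/-- The Gaussian integral over the region between two graphs over `u^⊥`. -/
theorem setIntegral_exp_between_graphs {u : E} (hu : ‖u‖ = 1) {φ₁ φ₂ : (ℝ ∙ u)ᗮ → ℝ} {A : Set E}
    (hA : MeasurableSet A) (hle : ∀ y, φ₁ y ≤ φ₂ y)
    (hmem : ∀ (y : (ℝ ∙ u)ᗮ) (s : ℝ), (y : E) + s • u ∈ A ↔ φ₁ y ≤ s ∧ s < φ₂ y) :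
    ∫ x in A, Real.exp (-‖x‖ ^ 2 / 2) =
      ∫ y : (ℝ ∙ u)ᗮ, Real.exp (-‖y‖ ^ 2 / 2) * ∫ s in φ₁ y..φ₂ y, Real.exp (-s ^ 2 / 2) := by
  obtain ⟨hmp, hemb⟩ := measurePreserving_add_smul hu
  set e := fun p : (ℝ ∙ u)ᗮ × ℝ => (p.1 : E) + p.2 • u with he
  have hg : ∀ p : (ℝ ∙ u)ᗮ × ℝ, Real.exp (-‖e p‖ ^ 2 / 2)
      = Real.exp (-‖p.1‖ ^ 2 / 2) * Real.exp (-p.2 ^ 2 / 2) := by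
    intro p
    rw [he, norm_sq_add_smul hu, ← Real.exp_add]
    ring_nf
  have hm : MeasurableSet (e ⁻¹' A) := hemb.measurable hA
  have hint : Integrable fun p : (ℝ ∙ u)ᗮ × ℝ => Real.exp (-‖e p‖ ^ 2 / 2) :=
    (hmp.integrable_comp_emb hemb (g := fun x : E => Real.exp (-‖x‖ ^ 2 / 2))).2
      (integrable_exp_neg_norm_sq_div_two E)
  rw [← hmp.setIntegral_preimage_emb hemb, ← integral_indicator hm, Measure.volume_eq_prod,
    integral_prod _ (hint.indicator hm)]
  refine integral_congr_ae (Eventually.of_forall fun y => ?_)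
  dsimp only
  rw [intervalIntegral.integral_of_le (hle y), ← integral_Ico_eq_integral_Ioc,
    ← integral_const_mul, ← integral_indicator measurableSet_Ico]
  refine integral_congr_ae (Eventually.of_forall fun s => ?_)
  have hiff : (y, s) ∈ e ⁻¹' A ↔ s ∈ Ico (φ₁ y) (φ₂ y) := hmem y s
  by_cases h : s ∈ Ico (φ₁ y) (φ₂ y)
  · simp only [indicator_of_mem h, indicator_of_mem (hiff.2 h), hg]
  · simp only [indicator_of_notMem h, indicator_of_notMem (fun h' => h (hiff.1 h'))]

end Slices

/-! ### Derivative of a maximum -/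

section Danskin

/-- Danskin's theorem: the derivative of a maximum whose maximizer is unique at `t = 0`. -/
theorem hasDerivAt_sSup_of_unique_max {X : Type*} [TopologicalSpace X] {ω : Set X}
    (hω : IsCompact ω) {g F : X → ℝ} (hg : ContinuousOn g ω) (hF : ContinuousOn F ω) {v₀ : X}
    (hv₀ : v₀ ∈ ω) (huniq : ∀ v ∈ ω, v ≠ v₀ → g v < g v₀) :
    HasDerivAt (fun t : ℝ => sSup ((fun v => g v + t * F v) '' ω)) (F v₀) 0 := by
  have hmax : ∀ v ∈ ω, g v ≤ g v₀ := fun v hv => by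
    by_cases h : v = v₀
    · rw [h]
    · exact (huniq v hv h).le
  have hc : ∀ t : ℝ, ContinuousOn (fun v => g v + t * F v) ω := fun t => by fun_prop
  have hbdd : ∀ t : ℝ, BddAbove ((fun v => g v + t * F v) '' ω) := fun t =>
    hω.bddAbove_image (hc t)
  obtain ⟨M, hM⟩ : ∃ M, ∀ v ∈ ω, |F v| ≤ M := by
    obtain ⟨M, hM⟩ := hω.exists_bound_of_continuousOn hF
    exact ⟨M, fun v hv => hM v hv⟩
  have hM0 : 0 ≤ M := (abs_nonneg _).trans (hM v₀ hv₀)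
  have h0 : sSup ((fun v => g v + 0 * F v) '' ω) = g v₀ := by
    refine IsGreatest.csSup_eq ⟨⟨v₀, hv₀, by ring⟩, ?_⟩
    rintro _ ⟨v, hv, rfl⟩
    simpa using hmax v hv
  rw [hasDerivAt_iff_isLittleO_nhds_zero, Asymptotics.isLittleO_iff]
  intro ε hε
  -- off the set `|F v - F v₀| < ε` the function `g` stays below its maximum by some `δ > 0`
  obtain ⟨δ, hδ, hfar⟩ : ∃ δ > 0, ∀ v ∈ ω, ε ≤ |F v - F v₀| → g v + δ ≤ g v₀ := by
    have hclosed : IsCompact (ω ∩ {v | ε ≤ |F v - F v₀|}) := by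
      obtain ⟨T, hT, hTe⟩ := (continuousOn_iff_isClosed.1
        ((hF.sub continuousOn_const).abs : ContinuousOn (fun v => |F v - F v₀|) ω)) (Ici ε)
          isClosed_Ici
      have : ω ∩ {v | ε ≤ |F v - F v₀|} = ω ∩ T := by
        rw [inter_comm ω T, ← hTe, inter_comm]
        rfl
      rw [this]
      exact hω.inter_right hT
    rcases (ω ∩ {v | ε ≤ |F v - F v₀|}).eq_empty_or_nonempty with he | hne
    · refine ⟨1, one_pos, fun v hv hv' => ?_⟩
      exact absurd (show v ∈ ω ∩ {v | ε ≤ |F v - F v₀|} from ⟨hv, hv'⟩) (by rw [he]; simp)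
    · obtain ⟨v₁, hv₁, hv₁m⟩ := hclosed.exists_isMaxOn hne (hg.mono inter_subset_left)
      have hlt : g v₁ < g v₀ := huniq v₁ hv₁.1 (by
        rintro rfl
        have : ε ≤ |F v₁ - F v₁| := hv₁.2
        simp at this
        linarith)
      refine ⟨g v₀ - g v₁, by linarith, fun v hv hv' => ?_⟩
      have : g v ≤ g v₁ := hv₁m ⟨hv, hv'⟩
      linarith
  -- On `ω`, `F` varies by at most `2 M`, so for such `t` the perturbation cannot make up the
  -- deficit `δ` of the far points.
  have hsmall : ∀ᶠ t in 𝓝 (0 : ℝ), |t| * (2 * M) < δ := by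
    have : Tendsto (fun t : ℝ => |t| * (2 * M)) (𝓝 0) (𝓝 (|0| * (2 * M))) :=
      (by fun_prop : Continuous fun t : ℝ => |t| * (2 * M)).tendsto 0
    rw [abs_zero, zero_mul] at this
    exact this.eventually_lt_const hδ
  filter_upwards [hsmall] with t ht
  rw [zero_add, h0, smul_eq_mul, Real.norm_eq_abs, Real.norm_eq_abs]
  have hlow : g v₀ + t * F v₀ ≤ sSup ((fun v => g v + t * F v) '' ω) :=
    le_csSup (hbdd t) ⟨v₀, hv₀, rfl⟩
  have hup : sSup ((fun v => g v + t * F v) '' ω) ≤ g v₀ + t * F v₀ + ε * |t| := by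
    refine csSup_le ⟨_, v₀, hv₀, rfl⟩ ?_
    rintro _ ⟨v, hv, rfl⟩
    dsimp only
    have hdiff : t * F v - t * F v₀ ≤ |t| * |F v - F v₀| := by
      rw [← mul_sub, ← abs_mul]
      exact le_abs_self _
    rcases le_or_gt ε |F v - F v₀| with hε' | hε'
    · have h1 := hfar v hv hε'
      have h2 : |F v - F v₀| ≤ 2 * M := by
        have := abs_sub (F v) (F v₀)
        linarith [hM v hv, hM v₀ hv₀]
      have h3 : |t| * |F v - F v₀| ≤ |t| * (2 * M) := by gcongr
      have h4 : 0 ≤ ε * |t| := by positivity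
      linarith
    · have h1 := hmax v hv
      have h3 : |t| * |F v - F v₀| ≤ |t| * ε := by gcongr
      linarith
  rw [abs_le]
  constructor
  · have h4 : 0 ≤ ε * |t| := by positivity
    linarith
  · linarith

end Danskin

/-! ### Support functions on compact subsets of `Ω_{C°}` -/

section Support

variable {n : ℕ} {C K ω : Set (EuclideanSpace ℝ (Fin n))}

/-- A closed `δ`-neighbourhood of the compact set `ω` stays in the polar cone. Moving `v` a distance
`δ` towards `x` keeps the product with `x` nonpositive while raising it by `δ ‖x‖`. -/
theorem exists_inner_le_neg_mul_norm (hωsub : ω ⊆ polarOmega C) (hω : IsCompact ω) :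
    ∃ c > 0, ∀ v ∈ ω, ∀ x ∈ C, ⟪x, v⟫ ≤ -c * ‖x‖ := by
  obtain ⟨δ, hδ, hsub⟩ := hω.exists_cthickening_subset_open isOpen_interior
    (hωsub.trans inter_subset_left)
  refine ⟨δ, hδ, fun v hv x hx => ?_⟩
  rcases eq_or_ne x 0 with rfl | hx0
  · simp
  have hxn : 0 < ‖x‖ := norm_pos_iff.2 hx0
  have hmem : v + (δ / ‖x‖) • x ∈ Metric.cthickening δ ω := by
    refine Metric.mem_cthickening_of_dist_le _ v δ ω hv ?_
    rw [dist_eq_norm, add_sub_cancel_left, norm_smul, Real.norm_eq_abs,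
      abs_of_pos (div_pos hδ hxn), div_mul_cancel₀ _ hxn.ne']
  have h := interior_subset (hsub hmem) x hx
  rw [inner_add_left, real_inner_smul_left, real_inner_self_eq_norm_sq, real_inner_comm] at h
  have : δ / ‖x‖ * ‖x‖ ^ 2 = δ * ‖x‖ := by
    field_simp
  linarith

theorem inner_le_supportFun (hK : IsCPseudoCone C K) {v x : EuclideanSpace ℝ (Fin n)}
    (hv : v ∈ polarCone C) (hx : x ∈ K) : ⟪x, v⟫ ≤ supportFun K v := by
  refine le_csSup ⟨0, ?_⟩ ⟨x, hx, rfl⟩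
  rintro _ ⟨z, hz, rfl⟩
  simpa only [real_inner_comm] using hv z (hK.subset hz)

theorem polarOmega_subset_polarCone : polarOmega C ⊆ polarCone C :=
  inter_subset_left.trans interior_subset

/-- `K` is closed and misses the origin, hence misses a ball of radius `r`; the uniform bound then
gives `⟪x, v⟫ ≤ -c r` on `K`. -/
theorem exists_pos_le_supportFunBar (hK : IsCPseudoCone C K) (hωsub : ω ⊆ polarOmega C)
    (hω : IsCompact ω) : ∃ m > 0, ∀ v ∈ ω, m ≤ supportFunBar K v := by
  obtain ⟨c, hc, hcω⟩ := exists_inner_le_neg_mul_norm hωsub hω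
  obtain ⟨r, hr, hball⟩ := Metric.isOpen_iff.1 hK.isClosed.isOpen_compl 0 hK.zero_notMem
  refine ⟨c * r, mul_pos hc hr, fun v hv => ?_⟩
  rw [supportFunBar, le_neg]
  refine csSup_le (hK.nonempty.image _) ?_
  rintro _ ⟨x, hx, rfl⟩
  have hxr : r ≤ ‖x‖ := by
    by_contra! h
    exact hball (by simpa using h) hx
  have := hcω v hv x (hK.subset hx)
  dsimp only
  nlinarith

/-- `K` is unbounded, but a point with `‖x‖ > ‖x₀‖ / c` satisfies `⟪x, v⟫ < -‖x₀‖ ≤ ⟪x₀, v⟫` and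
does not affect the supremum. A supremum over a bounded set is Lipschitz in `v`. -/
theorem continuousOn_supportFunBar (hK : IsCPseudoCone C K) (hωsub : ω ⊆ polarOmega C)
    (hω : IsCompact ω) : ContinuousOn (supportFunBar K) ω := by
  obtain ⟨c, hc, hcω⟩ := exists_inner_le_neg_mul_norm hωsub hω
  obtain ⟨x₀, hx₀⟩ := hK.nonempty
  -- The first summand bounds the relevant points of `K`; the second serves the comparison with `x₀`
  -- itself.
  set R := ‖x₀‖ / c + ‖x₀‖ with hR
  have hR0 : 0 ≤ R := by positivity
  have key : ∀ v ∈ ω, ∀ w ∈ ω, supportFun K v ≤ supportFun K w + R * dist v w := by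
    intro v hv w hw
    have hwp := polarOmega_subset_polarCone (hωsub hw)
    refine csSup_le (hK.nonempty.image _) ?_
    rintro _ ⟨x, hx, rfl⟩
    dsimp only
    have hsplit : ∀ z : EuclideanSpace ℝ (Fin n), ⟪z, v⟫ ≤ ⟪z, w⟫ + ‖z‖ * dist v w := by
      intro z
      have := real_inner_le_norm z (v - w)
      rw [inner_sub_right, ← dist_eq_norm] at this
      linarith
    have hd : 0 ≤ dist v w := dist_nonneg
    rcases le_or_gt ‖x‖ (‖x₀‖ / c) with h | h
    · have h1 := inner_le_supportFun hK hwp hx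
      have h2 := hsplit x
      have h3 : ‖x‖ * dist v w ≤ R * dist v w := by
        gcongr
        rw [hR]
        linarith [norm_nonneg x₀]
      linarith
    · have h1 := hcω v hv x (hK.subset hx)
      rw [div_lt_iff₀ hc] at h
      have h2 := abs_le.1 (abs_real_inner_le_norm x₀ v)
      have hv1 : ‖v‖ = 1 := by simpa using (hωsub hv).2
      rw [hv1, mul_one] at h2
      have h4 := inner_le_supportFun hK hwp hx₀
      have h5 := hsplit x₀
      have h3 : ‖x₀‖ * dist v w ≤ R * dist v w := by
        gcongr
        rw [hR]
        have : 0 ≤ ‖x₀‖ / c := by positivity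
        linarith
      nlinarith
  have hlip : LipschitzOnWith (Real.toNNReal R) (supportFun K) ω := by
    refine LipschitzOnWith.of_le_add_mul _ fun v hv w hw => ?_
    rw [Real.coe_toNNReal _ hR0]
    exact key v hv w hw
  exact hlip.continuousOn.neg

end Support

/-! ### The cone as an epigraph -/

section ConeHeight

variable {E : Type*} [NormedAddCommGroup E] [InnerProductSpace ℝ E]

/-- The function whose epigraph over `u^⊥`, in direction `u`, is the cone `C`. -/
noncomputable def coneHeight (C : ProperCone ℝ E) (u : E) (y : (ℝ ∙ u)ᗮ) : ℝ :=
  sInf {s : ℝ | (y : E) + s • u ∈ C}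

variable {C : ProperCone ℝ E} {u : E}

/-- If the ball of radius `r` about `u` lies in `C`, scaling gives `k = r⁻¹`. This constant is also
the Lipschitz constant of `coneHeight`. -/
theorem exists_forall_add_smul_mem (hu : u ∈ interior (C : Set E)) :
    ∃ k : ℝ≥0, ∀ z : E, z + (k * ‖z‖) • u ∈ C := by
  obtain ⟨r, hr, hball⟩ := Metric.nhds_basis_closedBall.mem_iff.1 (mem_interior_iff_mem_nhds.1 hu)
  refine ⟨Real.toNNReal r⁻¹, fun z => ?_⟩
  rw [Real.coe_toNNReal _ (inv_nonneg.2 hr.le)]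
  rcases eq_or_ne z 0 with rfl | hz
  · simp
  have hzn : 0 < ‖z‖ := norm_pos_iff.2 hz
  have hmem : u + (r / ‖z‖) • z ∈ C := by
    refine hball ?_
    rw [Metric.mem_closedBall, dist_eq_norm, add_sub_cancel_left, norm_smul, Real.norm_eq_abs,
      abs_of_pos (div_pos hr hzn), div_mul_cancel₀ _ hzn.ne']
  have := C.smul_mem hmem (show (0 : ℝ) ≤ r⁻¹ * ‖z‖ by positivity)
  rw [smul_add, smul_smul] at this
  have h1 : r⁻¹ * ‖z‖ * (r / ‖z‖) = 1 := by field_simp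
  rw [h1, one_smul, add_comm] at this
  exact this

theorem bddBelow_coneHeight {v : E} (hv : ∀ x ∈ C, ⟪x, v⟫ ≤ 0) (huv : ⟪u, v⟫ < 0)
    (y : (ℝ ∙ u)ᗮ) : BddBelow {s : ℝ | (y : E) + s • u ∈ C} := by
  refine ⟨⟪(y : E), v⟫ / (-⟪u, v⟫), fun s hs => ?_⟩
  have := hv _ hs
  rw [inner_add_left, real_inner_smul_left] at this
  rw [div_le_iff₀ (by linarith)]
  linarith

/-- The admissible heights form a closed half-line: upward closed since `u ∈ C`, nonempty since `u`
is interior, bounded below by the polar vector `v`. -/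
theorem add_smul_mem_iff_coneHeight_le (hu : u ∈ interior (C : Set E)) {v : E}
    (hv : ∀ x ∈ C, ⟪x, v⟫ ≤ 0) (huv : ⟪u, v⟫ < 0) (y : (ℝ ∙ u)ᗮ) (s : ℝ) :
    (y : E) + s • u ∈ C ↔ coneHeight C u y ≤ s := by
  have hbdd := bddBelow_coneHeight hv huv y
  refine ⟨fun h => csInf_le hbdd h, fun h => ?_⟩
  obtain ⟨k, hk⟩ := exists_forall_add_smul_mem hu
  have hne : {s : ℝ | (y : E) + s • u ∈ C}.Nonempty := ⟨_, hk y⟩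
  have hcl : IsClosed {s : ℝ | (y : E) + s • u ∈ C} :=
    C.isClosed.preimage (by fun_prop : Continuous fun s : ℝ => (y : E) + s • u)
  have hmem : (y : E) + coneHeight C u y • u ∈ C := hcl.csInf_mem hne hbdd
  have := add_mem hmem (C.smul_mem (interior_subset hu : u ∈ C) (sub_nonneg.2 h))
  rwa [add_assoc, ← add_smul, add_sub_cancel] at this

theorem exists_lipschitzWith_coneHeight (hu : u ∈ interior (C : Set E)) {v : E}
    (hv : ∀ x ∈ C, ⟪x, v⟫ ≤ 0) (huv : ⟪u, v⟫ < 0) :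
    ∃ k : ℝ≥0, LipschitzWith k (coneHeight C u) := by
  obtain ⟨k, hk⟩ := exists_forall_add_smul_mem hu
  refine ⟨k, LipschitzWith.of_le_add_mul _ fun y z => ?_⟩
  rw [← add_smul_mem_iff_coneHeight_le hu hv huv]
  have h1 : (z : E) + coneHeight C u z • u ∈ C :=
    (add_smul_mem_iff_coneHeight_le hu hv huv _ _).2 le_rfl
  have h2 := add_mem h1 (hk ((y : E) - z))
  rw [← Submodule.coe_sub, ← Submodule.coe_norm, ← dist_eq_norm, Submodule.coe_sub] at h2
  convert h2 using 1
  rw [add_smul]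
  abel

/-- The half of positive homogeneity used in `coneHeight_ne_wulffHeight`. -/
theorem mul_coneHeight_le (hu : u ∈ interior (C : Set E)) {v : E}
    (hv : ∀ x ∈ C, ⟪x, v⟫ ≤ 0) (huv : ⟪u, v⟫ < 0) {r : ℝ} (hr : 0 < r) (y : (ℝ ∙ u)ᗮ) :
    r * coneHeight C u y ≤ coneHeight C u (r • y) := by
  rw [← le_div_iff₀' hr, ← add_smul_mem_iff_coneHeight_le hu hv huv]
  have h1 : ((r • y : (ℝ ∙ u)ᗮ) : E) + coneHeight C u (r • y) • u ∈ C :=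
    (add_smul_mem_iff_coneHeight_le hu hv huv _ _).2 le_rfl
  have h2 := C.smul_mem h1 (inv_nonneg.2 hr.le)
  rw [Submodule.coe_smul, smul_add, smul_smul, inv_mul_cancel₀ hr.ne', one_smul, smul_smul] at h2
  rwa [div_eq_inv_mul]

end ConeHeight

/-! ### Normals at points of differentiability -/

section GaussNormal

variable {E : Type*} [NormedAddCommGroup E] [InnerProductSpace ℝ E] [FiniteDimensional ℝ E]

/-- The outer unit normal vector of the epigraph of `φ` at `graphMap u φ y`. -/
noncomputable def gaussNormal (u : E) (φ : (ℝ ∙ u)ᗮ → ℝ) (y : (ℝ ∙ u)ᗮ) : E :=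
  ‖((gradient φ y : (ℝ ∙ u)ᗮ) : E) - u‖⁻¹ • (((gradient φ y : (ℝ ∙ u)ᗮ) : E) - u)

/-- No regularity of `φ` is needed: `fderiv` is measurable everywhere, with default value `0` where
`φ` is not differentiable. -/
theorem measurable_gaussNormal [MeasurableSpace E] [BorelSpace E] (u : E) (φ : (ℝ ∙ u)ᗮ → ℝ) :
    Measurable (gaussNormal u φ) := by
  have h : Measurable (gradient φ) := by
    unfold gradient
    exact (LinearIsometryEquiv.continuous _).measurable.comp (measurable_fderiv ℝ φ)
  have h' : Measurable fun y => ((gradient φ y : (ℝ ∙ u)ᗮ) : E) - u :=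
    (measurable_subtype_coe.comp h).sub_const u
  exact h'.norm.inv.smul h'

/-- A supporting half-space with normal `v` puts an affine function of slope `⟪v, ·⟫ / (-⟪v, u⟫)`
below `φ`, touching at `y`. The difference has a minimum there, so the gradient is determined by
`v`, and conversely `v` by the gradient. -/
theorem eq_gaussNormal {u v : E} (hu : ‖u‖ = 1) (hv : ‖v‖ = 1) (huv : ⟪v, u⟫ < 0)
    {φ : (ℝ ∙ u)ᗮ → ℝ} {y : (ℝ ∙ u)ᗮ} (hφ : DifferentiableAt ℝ φ y)
    (hnormal : ∀ z, ⟪v, graphMap u φ z - graphMap u φ y⟫ ≤ 0) :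
    ((gradient φ y : (ℝ ∙ u)ᗮ) : E) = (-⟪v, u⟫)⁻¹ • v + u ∧ v = gaussNormal u φ y := by
  set b := -⟪v, u⟫ with hb
  have hb0 : 0 < b := by linarith
  have hfd : ∀ z : (ℝ ∙ u)ᗮ, fderiv ℝ φ y z = b⁻¹ * ⟪v, (z : E)⟫ := by
    intro z
    let ℓ : (ℝ ∙ u)ᗮ →L[ℝ] ℝ := b⁻¹ • (innerSL ℝ v).comp (ℝ ∙ u)ᗮ.subtypeL
    have hmin : IsLocalMin (fun z => φ z - ℓ z) y := by
      refine Eventually.of_forall fun z => ?_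
      have h := hnormal z
      simp only [graphMap, inner_sub_right, inner_add_right, real_inner_smul_right] at h
      have hz : ℓ z - ℓ y = b⁻¹ * (⟪v, (z : E)⟫ - ⟪v, (y : E)⟫) := by
        change b⁻¹ * ⟪v, (z : E)⟫ - b⁻¹ * ⟪v, (y : E)⟫ = _
        ring
      have : ℓ z - ℓ y ≤ φ z - φ y := by
        rw [hz, inv_mul_le_iff₀ hb0]
        have : ⟪v, u⟫ = -b := by rw [hb]; ring
        rw [this] at h
        linarith
      dsimp only
      linarith
    have h0 := hmin.hasFDerivAt_eq_zero (hφ.hasFDerivAt.sub ℓ.hasFDerivAt)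
    have := congrArg (fun g : (ℝ ∙ u)ᗮ →L[ℝ] ℝ => g z) h0
    simp only [sub_apply, zero_apply] at this
    exact sub_eq_zero.1 this
  have hmem : b⁻¹ • v + u ∈ (ℝ ∙ u)ᗮ := by
    rw [Submodule.mem_orthogonal_singleton_iff_inner_left, inner_add_left, real_inner_smul_left,
      real_inner_self_eq_norm_sq, hu]
    have : ⟪v, u⟫ = -b := by rw [hb]; ring
    rw [this]
    field_simp
    norm_num
  have hgrad : gradient φ y = ⟨b⁻¹ • v + u, hmem⟩ := by
    refine ext_inner_right ℝ fun z => ?_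
    rw [gradient, InnerProductSpace.toDual_symm_apply, hfd, Submodule.coe_inner, inner_add_left,
      real_inner_smul_left, real_inner_comm, ← real_inner_comm u, inner_coe_orthogonal, add_zero,
      real_inner_comm]
  refine ⟨by rw [hgrad], ?_⟩
  rw [gaussNormal, hgrad]
  dsimp only
  rw [add_sub_cancel_right, norm_smul, hv, mul_one, Real.norm_eq_abs,
    abs_of_pos (inv_pos.2 hb0), inv_inv, smul_smul, mul_inv_cancel₀ hb0.ne', one_smul]

end GaussNormal

/-! ### Wulff shapes as epigraphs and their variation in `t` -/

section WulffHeight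

variable {E : Type*} [NormedAddCommGroup E] [InnerProductSpace ℝ E]

/-- The function whose epigraph over `u^⊥`, in direction `u`, is the intersection of the half-spaces
`{x | ⟪x, v⟫ ≤ -(a v + t f v)}`, `v ∈ ω`. -/
noncomputable def wulffHeight (ω : Set E) (u : E) (a f : E → ℝ) (t : ℝ) (y : (ℝ ∙ u)ᗮ) : ℝ :=
  sSup ((fun v => (a v + ⟪v, (y : E)⟫) / (-⟪v, u⟫) + t * (f v / (-⟪v, u⟫))) '' ω)

/-- The function whose epigraph over `u^⊥`, in direction `u`, is the Wulff shape of `a + t f`. -/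
noncomputable def epiHeight (C : ProperCone ℝ E) (ω : Set E) (u : E) (a f : E → ℝ) (t : ℝ)
    (y : (ℝ ∙ u)ᗮ) : ℝ :=
  max (coneHeight C u y) (wulffHeight ω u a f t y)

/-- Data for the Wulff shapes of the functions `a + t f` on a compact set `ω` of unit vectors in the
interior of the polar cone of `C`, with a unit vector `u` in the interior of `C`. -/
structure IsWulffData (C : ProperCone ℝ E) (ω : Set E) (u : E) (a f : E → ℝ) (c : ℝ) : Prop where
  mem_interior : u ∈ interior (C : Set E)
  norm_eq : ‖u‖ = 1
  isCompact : IsCompact ω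
  nonempty : ω.Nonempty
  norm_eq_one : ∀ v ∈ ω, ‖v‖ = 1
  pos : 0 < c
  inner_le : ∀ v ∈ ω, ∀ x ∈ C, ⟪x, v⟫ ≤ -c * ‖x‖
  positive : ∀ v ∈ ω, 0 < a v
  continuousOn_left : ContinuousOn a ω
  continuousOn_right : ContinuousOn f ω

namespace IsWulffData

variable {C : ProperCone ℝ E} {ω : Set E} {u : E} {a f : E → ℝ} {c : ℝ}

theorem le_neg_inner (h : IsWulffData C ω u a f c) {v : E} (hv : v ∈ ω) : c ≤ -⟪v, u⟫ := by
  have := h.inner_le v hv u (interior_subset h.mem_interior)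
  rw [h.norm_eq, real_inner_comm] at this
  linarith

theorem neg_inner_pos (h : IsWulffData C ω u a f c) {v : E} (hv : v ∈ ω) : 0 < -⟪v, u⟫ :=
  h.pos.trans_le (h.le_neg_inner hv)

theorem inner_nonpos (h : IsWulffData C ω u a f c) {v : E} (hv : v ∈ ω) :
    ∀ x ∈ C, ⟪x, v⟫ ≤ 0 := fun x hx => by
  have h1 := h.inner_le v hv x hx
  have h2 : 0 ≤ c * ‖x‖ := mul_nonneg h.pos.le (norm_nonneg x)
  linarith

theorem inner_neg (h : IsWulffData C ω u a f c) {v : E} (hv : v ∈ ω) : ⟪u, v⟫ < 0 := by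
  have := h.neg_inner_pos hv
  rw [real_inner_comm] at this
  linarith

theorem continuousOn_div (h : IsWulffData C ω u a f c) {g : E → ℝ} (hg : ContinuousOn g ω) :
    ContinuousOn (fun v => g v / (-⟪v, u⟫)) ω :=
  hg.div (by fun_prop) fun _ hv => (h.neg_inner_pos hv).ne'

theorem continuousOn_const_term (h : IsWulffData C ω u a f c) (y : (ℝ ∙ u)ᗮ) :
    ContinuousOn (fun v => (a v + ⟪v, (y : E)⟫) / (-⟪v, u⟫)) ω :=
  h.continuousOn_div (h.continuousOn_left.add (by fun_prop))

theorem continuousOn_term (h : IsWulffData C ω u a f c) (t : ℝ) (y : (ℝ ∙ u)ᗮ) :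
    ContinuousOn (fun v => (a v + ⟪v, (y : E)⟫) / (-⟪v, u⟫) + t * (f v / (-⟪v, u⟫))) ω :=
  (h.continuousOn_const_term y).add
    (continuousOn_const.mul (h.continuousOn_div h.continuousOn_right))

theorem term_le_iff (h : IsWulffData C ω u a f c) {v : E} (hv : v ∈ ω) (t s : ℝ)
    (y : (ℝ ∙ u)ᗮ) : (a v + ⟪v, (y : E)⟫) / (-⟪v, u⟫) + t * (f v / (-⟪v, u⟫)) ≤ s ↔
      ⟪(y : E) + s • u, v⟫ ≤ -(a v + t * f v) := by
  rw [← mul_div_assoc, ← add_div, div_le_iff₀ (h.neg_inner_pos hv), inner_add_left,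
    real_inner_smul_left, real_inner_comm (y : E), real_inner_comm u]
  constructor <;> intro h <;> linarith

theorem term_le_wulffHeight (h : IsWulffData C ω u a f c) {v : E} (hv : v ∈ ω) (t : ℝ)
    (y : (ℝ ∙ u)ᗮ) :
    (a v + ⟪v, (y : E)⟫) / (-⟪v, u⟫) + t * (f v / (-⟪v, u⟫)) ≤ wulffHeight ω u a f t y :=
  le_csSup (h.isCompact.bddAbove_image (h.continuousOn_term t y)) ⟨v, hv, rfl⟩

theorem exists_wulffHeight_eq (h : IsWulffData C ω u a f c) (t : ℝ) (y : (ℝ ∙ u)ᗮ) :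
    ∃ v ∈ ω, wulffHeight ω u a f t y =
      (a v + ⟪v, (y : E)⟫) / (-⟪v, u⟫) + t * (f v / (-⟪v, u⟫)) :=
  h.isCompact.exists_sSup_image_eq h.nonempty (h.continuousOn_term t y)

theorem wulffHeight_le_iff (h : IsWulffData C ω u a f c) (t s : ℝ) (y : (ℝ ∙ u)ᗮ) :
    wulffHeight ω u a f t y ≤ s ↔ ∀ v ∈ ω, ⟪(y : E) + s • u, v⟫ ≤ -(a v + t * f v) := by
  constructor
  · intro hs v hv
    exact (h.term_le_iff hv t s y).1 ((h.term_le_wulffHeight hv t y).trans hs)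
  · intro hs
    obtain ⟨v, hv, he⟩ := h.exists_wulffHeight_eq t y
    rw [he]
    exact (h.term_le_iff hv t s y).2 (hs v hv)

theorem epiHeight_le_iff (h : IsWulffData C ω u a f c) (t s : ℝ) (y : (ℝ ∙ u)ᗮ) :
    epiHeight C ω u a f t y ≤ s ↔ (y : E) + s • u ∈ C ∧
      ∀ v ∈ ω, ⟪(y : E) + s • u, v⟫ ≤ -(a v + t * f v) := by
  obtain ⟨v, hv⟩ := h.nonempty
  rw [epiHeight, max_le_iff, h.wulffHeight_le_iff,
    add_smul_mem_iff_coneHeight_le h.mem_interior (h.inner_nonpos hv) (h.inner_neg hv)]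

/-- Each competing affine function has slope at most `‖v‖ / (-⟪v, u⟫) ≤ c⁻¹`. -/
theorem lipschitzWith_wulffHeight (h : IsWulffData C ω u a f c) (t : ℝ) :
    LipschitzWith (Real.toNNReal c⁻¹) (wulffHeight ω u a f t) := by
  refine LipschitzWith.of_le_add_mul _ fun y z => ?_
  rw [Real.coe_toNNReal _ (inv_nonneg.2 h.pos.le)]
  obtain ⟨v, hv, he⟩ := h.exists_wulffHeight_eq t y
  have hz := h.term_le_wulffHeight hv t z
  have hb := h.neg_inner_pos hv
  have hd : ⟪v, (y : E)⟫ - ⟪v, (z : E)⟫ ≤ dist y z := by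
    rw [← inner_sub_right]
    refine (real_inner_le_norm _ _).trans ?_
    rw [h.norm_eq_one v hv, one_mul, dist_eq_norm, Submodule.coe_norm, Submodule.coe_sub]
  have h1 : (a v + ⟪v, (y : E)⟫) / (-⟪v, u⟫) - (a v + ⟪v, (z : E)⟫) / (-⟪v, u⟫)
      ≤ c⁻¹ * dist y z := by
    rw [← sub_div, add_sub_add_left_eq_sub, ← div_eq_inv_mul]
    exact (div_le_div_of_nonneg_right hd hb.le).trans
      (div_le_div_of_nonneg_left dist_nonneg h.pos (h.le_neg_inner hv))
  linarith

theorem exists_lipschitzWith_wulffHeight_param (h : IsWulffData C ω u a f c) :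
    ∃ M : ℝ≥0, ∀ y, LipschitzWith M fun t => wulffHeight ω u a f t y := by
  obtain ⟨M, hM⟩ := h.isCompact.exists_bound_of_continuousOn
    (h.continuousOn_div h.continuousOn_right)
  refine ⟨Real.toNNReal M, fun y => LipschitzWith.of_le_add_mul _ fun t s => ?_⟩
  obtain ⟨v, hv, he⟩ := h.exists_wulffHeight_eq t y
  have hz := h.term_le_wulffHeight hv s y
  have h1 : t * (f v / (-⟪v, u⟫)) - s * (f v / (-⟪v, u⟫)) ≤ Real.toNNReal M * dist t s := by
    rw [← sub_mul, mul_comm _ (dist t s), Real.dist_eq]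
    refine (le_abs_self _).trans ?_
    rw [abs_mul]
    gcongr
    exact (hM v hv).trans (Real.le_coe_toNNReal M)
  linarith

theorem exists_lipschitzWith_epiHeight (h : IsWulffData C ω u a f c) :
    ∃ k : ℝ≥0, ∀ t, LipschitzWith k (epiHeight C ω u a f t) := by
  obtain ⟨v, hv⟩ := h.nonempty
  obtain ⟨k, hk⟩ := exists_lipschitzWith_coneHeight h.mem_interior (h.inner_nonpos hv)
    (h.inner_neg hv)
  exact ⟨max k _, fun t => hk.max (h.lipschitzWith_wulffHeight t)⟩

/-- That `M` does not depend on `y` is what dominates the difference quotients of the co-volume. -/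
theorem exists_lipschitzWith_epiHeight_param (h : IsWulffData C ω u a f c) :
    ∃ M : ℝ≥0, ∀ y, LipschitzWith M fun t => epiHeight C ω u a f t y := by
  obtain ⟨M, hM⟩ := h.exists_lipschitzWith_wulffHeight_param
  exact ⟨M, fun y => (hM y).const_max _⟩

theorem continuous_coneHeight (h : IsWulffData C ω u a f c) : Continuous (coneHeight C u) := by
  obtain ⟨v, hv⟩ := h.nonempty
  obtain ⟨k, hk⟩ := exists_lipschitzWith_coneHeight h.mem_interior (h.inner_nonpos hv)
    (h.inner_neg hv)
  exact hk.continuous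

theorem continuous_epiHeight (h : IsWulffData C ω u a f c) (t : ℝ) :
    Continuous (epiHeight C ω u a f t) := by
  obtain ⟨k, hk⟩ := h.exists_lipschitzWith_epiHeight
  exact (hk t).continuous

theorem graphMap_mem (h : IsWulffData C ω u a f c) (y : (ℝ ∙ u)ᗮ) :
    graphMap u (epiHeight C ω u a f 0) y ∈ C ∧
      ∀ v ∈ ω, ⟪graphMap u (epiHeight C ω u a f 0) y, v⟫ ≤ -a v := by
  simpa [graphMap] using (h.epiHeight_le_iff 0 _ y).1 le_rfl

theorem inner_graphMap_sub_nonpos (h : IsWulffData C ω u a f c) {v : E} (hv : v ∈ ω)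
    {y : (ℝ ∙ u)ᗮ} (hy : ⟪graphMap u (epiHeight C ω u a f 0) y, v⟫ = -a v) (z : (ℝ ∙ u)ᗮ) :
    ⟪v, graphMap u (epiHeight C ω u a f 0) z - graphMap u (epiHeight C ω u a f 0) y⟫ ≤ 0 := by
  have := (h.graphMap_mem z).2 v hv
  rw [inner_sub_right, real_inner_comm _ v, real_inner_comm _ v, hy]
  linarith

/-- Turns maximizers in the supremum into outer normals, to which `eq_gaussNormal` applies. -/
theorem inner_graphMap_eq (h : IsWulffData C ω u a f c) {y : (ℝ ∙ u)ᗮ}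
    (hy : coneHeight C u y ≤ wulffHeight ω u a f 0 y) {v : E} (hv : v ∈ ω)
    (he : wulffHeight ω u a f 0 y = (a v + ⟪v, (y : E)⟫) / (-⟪v, u⟫)) :
    ⟪graphMap u (epiHeight C ω u a f 0) y, v⟫ = -a v := by
  rw [eq_div_iff (h.neg_inner_pos hv).ne'] at he
  rw [graphMap, epiHeight, max_eq_right hy, inner_add_left, real_inner_smul_left,
    real_inner_comm v (y : E), real_inner_comm v u]
  linarith

variable [FiniteDimensional ℝ E]

/-- If both heights agreed at a differentiability point, the boundary would touch the cone from
above, making its tangent hyperplane contain the ray through that point and so the origin. But the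
tangent hyperplane is `⟪x, v⟫ = -a v` with `a v > 0`. -/
theorem coneHeight_ne_wulffHeight (h : IsWulffData C ω u a f c) {y : (ℝ ∙ u)ᗮ}
    (hd : DifferentiableAt ℝ (epiHeight C ω u a f 0) y) :
    coneHeight C u y ≠ wulffHeight ω u a f 0 y := by
  intro heq
  obtain ⟨v, hv, he⟩ := h.exists_wulffHeight_eq 0 y
  rw [zero_mul, add_zero] at he
  have hcontact := h.inner_graphMap_eq heq.le hv he
  have hb := h.neg_inner_pos hv
  set φ := epiHeight C ω u a f 0 with hφ
  have hgrad := (eq_gaussNormal h.norm_eq (h.norm_eq_one v hv) (by linarith) hd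
    (h.inner_graphMap_sub_nonpos hv hcontact)).1
  have hφy : φ y = coneHeight C u y := max_eq_left heq.ge
  -- `φ` lies above the cone height, equals it at `y`, and the cone height at `r • y` is at least
  -- `r` times that at `y`.
  have hmin : IsLocalMin (fun r : ℝ => φ (r • y) - r * φ y) 1 := by
    filter_upwards [lt_mem_nhds (one_pos : (0 : ℝ) < 1)] with r hr
    have h1 : coneHeight C u (r • y) ≤ φ (r • y) := le_max_left _ _
    have h2 := mul_coneHeight_le h.mem_interior (h.inner_nonpos hv) (h.inner_neg hv) hr y
    rw [one_smul, one_mul, sub_self, hφy]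
    linarith
  have hd1 : HasDerivAt (fun r : ℝ => r • y) y 1 := by
    simpa using (hasDerivAt_id (1 : ℝ)).smul_const y
  have hfd : HasFDerivAt φ (fderiv ℝ φ y) ((1 : ℝ) • y) := by
    rw [one_smul]
    exact hd.hasFDerivAt
  have hd2 := (hfd.comp_hasDerivAt (1 : ℝ) hd1).sub ((hasDerivAt_id (1 : ℝ)).mul_const (φ y))
  have h0 := hmin.hasDerivAt_eq_zero hd2
  have hin : fderiv ℝ φ y y = ⟪((gradient φ y : (ℝ ∙ u)ᗮ) : E), (y : E)⟫ := by
    rw [← Submodule.coe_inner, gradient, InnerProductSpace.toDual_symm_apply]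
  -- Stationarity at `r = 1` reads `⟪∇φ(y), y⟫ = φ y`; inserting the gradient gives product `0` with
  -- `v` at the contact point.
  rw [hin, hgrad, inner_add_left, real_inner_smul_left, ← real_inner_comm u,
    inner_coe_orthogonal] at h0
  rw [graphMap, inner_add_left, real_inner_smul_left, real_inner_comm v (y : E),
    real_inner_comm v u] at hcontact
  have hpos := h.positive v hv
  have hb' : ⟪v, u⟫ ≠ 0 := by linarith
  field_simp at h0
  nlinarith

/-- The derivative in `t` of the boundary of the Wulff shape of `a + t f`, in direction `u`. -/
theorem hasDerivAt_epiHeight (h : IsWulffData C ω u a f c) {y : (ℝ ∙ u)ᗮ}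
    (hd : DifferentiableAt ℝ (epiHeight C ω u a f 0) y) :
    (coneHeight C u y < epiHeight C ω u a f 0 y →
      gaussNormal u (epiHeight C ω u a f 0) y ∈ ω ∧
      (∀ z, ⟪gaussNormal u (epiHeight C ω u a f 0) y,
        graphMap u (epiHeight C ω u a f 0) z - graphMap u (epiHeight C ω u a f 0) y⟫ ≤ 0) ∧
      ⟪graphMap u (epiHeight C ω u a f 0) y, gaussNormal u (epiHeight C ω u a f 0) y⟫
        = -a (gaussNormal u (epiHeight C ω u a f 0) y) ∧
      HasDerivAt (fun t => epiHeight C ω u a f t y)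
        (f (gaussNormal u (epiHeight C ω u a f 0) y) /
          (-⟪gaussNormal u (epiHeight C ω u a f 0) y, u⟫)) 0) ∧
    (¬ coneHeight C u y < epiHeight C ω u a f 0 y →
      HasDerivAt (fun t => epiHeight C ω u a f t y) 0 0) := by
  have hne := h.coneHeight_ne_wulffHeight hd
  obtain ⟨M, hM⟩ := h.exists_lipschitzWith_wulffHeight_param
  have hct : ContinuousAt (fun t => wulffHeight ω u a f t y) 0 := (hM y).continuous.continuousAt
  rcases lt_or_gt_of_ne hne with hlt | hgt
  · have hlt' : coneHeight C u y < epiHeight C ω u a f 0 y := lt_max_of_lt_right hlt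
    refine ⟨fun _ => ?_, fun hn => absurd hlt' hn⟩
    have hun : ∀ v ∈ ω, wulffHeight ω u a f 0 y = (a v + ⟪v, (y : E)⟫) / (-⟪v, u⟫) →
        v = gaussNormal u (epiHeight C ω u a f 0) y := fun v hv he =>
      (eq_gaussNormal h.norm_eq (h.norm_eq_one v hv) (by linarith [h.neg_inner_pos hv]) hd
        (h.inner_graphMap_sub_nonpos hv (h.inner_graphMap_eq hlt.le hv he))).2
    obtain ⟨v, hv, he⟩ := h.exists_wulffHeight_eq 0 y
    rw [zero_mul, add_zero] at he
    have hvN := hun v hv he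
    rw [← hvN]
    have hcontact := h.inner_graphMap_eq hlt.le hv he
    refine ⟨hv, h.inner_graphMap_sub_nonpos hv hcontact, hcontact, ?_⟩
    have hder := hasDerivAt_sSup_of_unique_max h.isCompact (h.continuousOn_const_term y)
      (h.continuousOn_div h.continuousOn_right) hv (fun w hw hwv => by
        have h1 := h.term_le_wulffHeight hw 0 y
        rw [zero_mul, add_zero] at h1
        refine lt_of_le_of_ne (h1.trans_eq he) fun hwe => hwv ?_
        rw [hun w hw (he.trans hwe.symm), hvN])
    refine hder.congr_of_eventuallyEq ?_
    -- The strict inequality persists for small `t`, so the maximum is locally its Wulff branch.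
    filter_upwards [hct.eventually_const_lt hlt] with t ht
    exact max_eq_right ht.le
  · have hn : ¬ coneHeight C u y < epiHeight C ω u a f 0 y := by
      rw [epiHeight, max_eq_left hgt.le]
      exact lt_irrefl _
    refine ⟨fun h' => absurd h' hn, fun _ => ?_⟩
    refine (hasDerivAt_const (0 : ℝ) (coneHeight C u y)).congr_of_eventuallyEq ?_
    filter_upwards [hct.eventually_lt_const hgt] with t ht
    exact max_eq_left ht.le

end IsWulffData
end WulffHeight

/-! ### A bounded, 1-Lipschitz Gaussian primitive -/

section GaussPrimitive

/-- The primitive of `exp(-s²/2)` vanishing at `0`. -/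
noncomputable def gaussPrimitive (s : ℝ) : ℝ := ∫ r in (0 : ℝ)..s, Real.exp (-r ^ 2 / 2)

theorem hasDerivAt_gaussPrimitive (s : ℝ) :
    HasDerivAt gaussPrimitive (Real.exp (-s ^ 2 / 2)) s :=
  (Continuous.integral_hasStrictDerivAt (by fun_prop) 0 s).hasDerivAt

theorem continuous_gaussPrimitive : Continuous gaussPrimitive :=
  continuous_iff_continuousAt.2 fun s => (hasDerivAt_gaussPrimitive s).continuousAt

theorem integral_exp_eq_gaussPrimitive_sub (a b : ℝ) :
    ∫ r in a..b, Real.exp (-r ^ 2 / 2) = gaussPrimitive b - gaussPrimitive a := by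
  have hint : ∀ a b : ℝ, IntervalIntegrable (fun r : ℝ => Real.exp (-r ^ 2 / 2)) volume a b :=
    fun a b => (by fun_prop : Continuous fun r : ℝ => Real.exp (-r ^ 2 / 2)).intervalIntegrable _ _
  exact (intervalIntegral.integral_interval_sub_left (hint 0 b) (hint 0 a)).symm

theorem lipschitzWith_gaussPrimitive : LipschitzWith 1 gaussPrimitive := by
  refine lipschitzWith_of_nnnorm_deriv_le (fun s => (hasDerivAt_gaussPrimitive s).differentiableAt)
    fun s => ?_
  rw [(hasDerivAt_gaussPrimitive s).deriv, ← NNReal.coe_le_coe, coe_nnnorm, Real.norm_eq_abs,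
    Real.abs_exp, NNReal.coe_one, Real.exp_le_one_iff]
  have := sq_nonneg s
  linarith

theorem exists_abs_gaussPrimitive_le : ∃ B, ∀ s, |gaussPrimitive s| ≤ B := by
  have hint : Integrable fun r : ℝ => ‖Real.exp (-r ^ 2 / 2)‖ := by
    have := (integrable_exp_neg_norm_sq_div_two ℝ).norm
    simpa only [Real.norm_eq_abs, sq_abs] using this
  refine ⟨_, fun s => (intervalIntegral.norm_integral_le_integral_norm_uIoc).trans
    (setIntegral_le_integral hint (Eventually.of_forall fun r => norm_nonneg _))⟩

end GaussPrimitive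

/-! ### Interior and frontier of an epigraph -/

section Epigraph

variable {E : Type*} [NormedAddCommGroup E] [InnerProductSpace ℝ E]

theorem exists_eq_add_smul {u : E} (hu : ‖u‖ = 1) (x : E) :
    x = ((ℝ ∙ u)ᗮ.orthogonalProjectionOnto x : E) + ⟪u, x⟫ • u := by
  have h1 : (ℝ ∙ u).starProjection x = ⟪u, x⟫ • u := Submodule.starProjection_unit_singleton ℝ hu x
  have h2 := Submodule.starProjection_add_starProjection_orthogonal (K := ℝ ∙ u) x
  rw [h1, add_comm] at h2
  exact h2.symm

theorem add_smul_mem_interior_iff {u : E} (hu : ‖u‖ = 1) {A : Set E} {θ : (ℝ ∙ u)ᗮ → ℝ}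
    (hθ : Continuous θ) (hA : ∀ (y : (ℝ ∙ u)ᗮ) (s : ℝ), (y : E) + s • u ∈ A ↔ θ y ≤ s)
    (y : (ℝ ∙ u)ᗮ) (s : ℝ) : (y : E) + s • u ∈ interior A ↔ θ y < s := by
  constructor
  · intro h
    have hc : Tendsto (fun r : ℝ => (y : E) + (s - r) • u) (𝓝[>] 0)
        (𝓝 ((y : E) + (s - 0) • u)) :=
      ((by fun_prop : Continuous fun r : ℝ => (y : E) + (s - r) • u).tendsto 0).mono_left
        nhdsWithin_le_nhds
    rw [sub_zero] at hc
    obtain ⟨r, hr, hr0⟩ :=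
      ((hc.eventually (mem_interior_iff_mem_nhds.1 h)).and self_mem_nhdsWithin).exists
    have h1 := (hA y (s - r)).1 hr
    have h2 : 0 < r := hr0
    linarith
  · intro h
    refine mem_interior.2 ⟨{x | θ ((ℝ ∙ u)ᗮ.orthogonalProjectionOnto x) < ⟪u, x⟫}, ?_, ?_, ?_⟩
    · intro x hx
      rw [exists_eq_add_smul hu x, hA]
      exact le_of_lt hx
    · exact isOpen_lt (hθ.comp (ContinuousLinearMap.continuous _)) (by fun_prop)
    · have h1 := orthogonalProjectionOnto_graphMap u (fun _ => s) y
      rw [graphMap] at h1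
      rw [mem_ofPred_eq, h1, inner_add_right, real_inner_smul_right, real_inner_self_eq_norm_sq, hu,
        real_inner_comm, inner_coe_orthogonal]
      simpa using h

theorem add_smul_mem_frontier_iff {u : E} (hu : ‖u‖ = 1) {A : Set E} (hcl : IsClosed A)
    {θ : (ℝ ∙ u)ᗮ → ℝ} (hθ : Continuous θ)
    (hA : ∀ (y : (ℝ ∙ u)ᗮ) (s : ℝ), (y : E) + s • u ∈ A ↔ θ y ≤ s)
    (y : (ℝ ∙ u)ᗮ) (s : ℝ) : (y : E) + s • u ∈ frontier A ↔ θ y = s := by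
  rw [hcl.frontier_eq, Set.mem_sdiff, hA, add_smul_mem_interior_iff hu hθ hA, not_lt, le_antisymm_iff]

end Epigraph

/-! ### Differentiation under the integral -/

section Derivative

variable {E : Type*} [NormedAddCommGroup E] [InnerProductSpace ℝ E] [MeasurableSpace E]
  [BorelSpace E]

/-- Since `f` is arbitrary off `ω`, its indicator is what gets composed with the Gauss normal. -/
theorem _root_.ContinuousOn.measurable_indicator {X : Type*} [TopologicalSpace X]
    [MeasurableSpace X] [BorelSpace X] {s : Set X} {f : X → ℝ} (hf : ContinuousOn f s)
    (hs : MeasurableSet s) : Measurable (s.indicator f) := by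
  classical
  rw [← piecewise_eq_indicator]
  exact hf.measurable_piecewise continuousOn_const hs

/-- The points over which the boundary of the Wulff shape of `a` is smooth and interior to `C`. -/
def regularSet (C : ProperCone ℝ E) (ω : Set E) (u : E) (a f : E → ℝ) : Set (ℝ ∙ u)ᗮ :=
  {y | coneHeight C u y < epiHeight C ω u a f 0 y ∧
    DifferentiableAt ℝ (epiHeight C ω u a f 0) y}

namespace IsWulffData

variable {C : ProperCone ℝ E} {ω : Set E} {u : E} {a f : E → ℝ} {c : ℝ}

theorem measurableSet_regularSet (h : IsWulffData C ω u a f c) :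
    MeasurableSet (regularSet C ω u a f) :=
  (isOpen_lt h.continuous_coneHeight (h.continuous_epiHeight 0)).measurableSet.inter
    (measurableSet_of_differentiableAt ℝ _)

variable [FiniteDimensional ℝ E]

theorem ae_differentiableAt (h : IsWulffData C ω u a f c) :
    ∀ᵐ y, DifferentiableAt ℝ (epiHeight C ω u a f 0) y := by
  obtain ⟨k, hk⟩ := h.exists_lipschitzWith_epiHeight
  exact (hk 0).ae_differentiableAt

/-- The primitive is 1-Lipschitz and the heights are `M`-Lipschitz in `t`, so the Gaussian weight
times `M` dominates. Points over the cone boundary contribute `0`, and by Pythagoras the two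
exponentials combine into the weight at the graph point. -/
theorem hasDerivAt_integral (h : IsWulffData C ω u a f c) :
    HasDerivAt (fun t => ∫ y : (ℝ ∙ u)ᗮ, Real.exp (-‖y‖ ^ 2 / 2) *
        ∫ s in coneHeight C u y..epiHeight C ω u a f t y, Real.exp (-s ^ 2 / 2))
      (∫ y in regularSet C ω u a f,
        Real.exp (-‖graphMap u (epiHeight C ω u a f 0) y‖ ^ 2 / 2) *
          (ω.indicator f (gaussNormal u (epiHeight C ω u a f 0) y) /
            (-⟪gaussNormal u (epiHeight C ω u a f 0) y, u⟫))) 0 := by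
  simp only [integral_exp_eq_gaussPrimitive_sub]
  rw [← integral_indicator h.measurableSet_regularSet]
  obtain ⟨M, hM⟩ := h.exists_lipschitzWith_epiHeight_param
  obtain ⟨B, hB⟩ := exists_abs_gaussPrimitive_le
  have hw : Integrable fun y : (ℝ ∙ u)ᗮ => Real.exp (-‖y‖ ^ 2 / 2) :=
    integrable_exp_neg_norm_sq_div_two _
  have hcone := h.continuous_coneHeight
  have hepi := h.continuous_epiHeight
  have hN := measurable_gaussNormal u (epiHeight C ω u a f 0)
  have hG := continuous_gaussPrimitive
  have hcont : ∀ t, Continuous fun y => gaussPrimitive (epiHeight C ω u a f t y) -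
      gaussPrimitive (coneHeight C u y) := fun t =>
    (hG.comp (hepi t)).sub (hG.comp hcone)
  refine (hasDerivAt_integral_of_dominated_loc_of_lip (s := univ)
    (bound := fun y : (ℝ ∙ u)ᗮ => Real.exp (-‖y‖ ^ 2 / 2) * M) univ_mem ?_ ?_ ?_ ?_ ?_ ?_).2
  · refine Eventually.of_forall fun t => Continuous.aestronglyMeasurable ?_
    exact (by fun_prop : Continuous fun y : (ℝ ∙ u)ᗮ => Real.exp (-‖y‖ ^ 2 / 2)).mul (hcont t)
  · refine hw.mul_bdd (c := B + B) (hcont 0).aestronglyMeasurable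
      (Eventually.of_forall fun y => ?_)
    exact (norm_sub_le _ _).trans (add_le_add (hB _) (hB _))
  · refine (Measurable.indicator ?_ h.measurableSet_regularSet).aestronglyMeasurable
    have h1 : Measurable fun y =>
        Real.exp (-‖graphMap u (epiHeight C ω u a f 0) y‖ ^ 2 / 2) := by
      have := continuous_graphMap u (hepi 0)
      exact (by fun_prop : Continuous _).measurable
    have h2 := (h.continuousOn_right.measurable_indicator h.isCompact.measurableSet).comp hN
    exact h1.mul (h2.div (hN.inner measurable_const).neg)
  · refine Eventually.of_forall fun y => LipschitzOnWith.of_dist_le_mul fun t _ s _ => ?_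
    rw [Real.dist_eq, ← mul_sub, sub_sub_sub_cancel_right, abs_mul, Real.abs_exp, Real.coe_nnabs,
      abs_mul, Real.abs_exp, NNReal.abs_eq, mul_assoc]
    gcongr
    have h1 := lipschitzWith_gaussPrimitive.dist_le_mul (epiHeight C ω u a f t y)
      (epiHeight C ω u a f s y)
    rw [NNReal.coe_one, one_mul, Real.dist_eq] at h1
    exact h1.trans ((hM y).dist_le_mul t s)
  · exact hw.mul_const _
  · filter_upwards [h.ae_differentiableAt] with y hd
    have hder := h.hasDerivAt_epiHeight hd
    have hcomp : ∀ D, HasDerivAt (fun t => epiHeight C ω u a f t y) D 0 →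
        HasDerivAt (fun t => Real.exp (-‖y‖ ^ 2 / 2) *
          (gaussPrimitive (epiHeight C ω u a f t y) - gaussPrimitive (coneHeight C u y)))
          (Real.exp (-‖y‖ ^ 2 / 2) * (Real.exp (-(epiHeight C ω u a f 0 y) ^ 2 / 2) * D)) 0 :=
      fun D hD =>
        (((hasDerivAt_gaussPrimitive _).comp (0 : ℝ) hD).sub_const _).const_mul _
    by_cases hlt : coneHeight C u y < epiHeight C ω u a f 0 y
    · obtain ⟨hNω, -, -, hD⟩ := hder.1 hlt
      rw [indicator_of_mem (show y ∈ regularSet C ω u a f from ⟨hlt, hd⟩), indicator_of_mem hNω]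
      have hexp : Real.exp (-‖graphMap u (epiHeight C ω u a f 0) y‖ ^ 2 / 2) =
          Real.exp (-‖y‖ ^ 2 / 2) * Real.exp (-(epiHeight C ω u a f 0 y) ^ 2 / 2) := by
        rw [graphMap, norm_sq_add_smul h.norm_eq, ← Real.exp_add]
        ring_nf
      rw [hexp, mul_assoc]
      exact hcomp _ hD
    · rw [indicator_of_notMem (fun hy : y ∈ regularSet C ω u a f => hlt hy.1)]
      simpa using hcomp 0 (hder.2 hlt)

end IsWulffData
end Derivative

/-! ### The Gaussian surface area measure as an image measure -/

section SurfaceMeasure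

variable {n : ℕ} {C : ProperCone ℝ (EuclideanSpace ℝ (Fin n))} {ω : Set (EuclideanSpace ℝ (Fin n))}
  {u : EuclideanSpace ℝ (Fin n)} {a f : EuclideanSpace ℝ (Fin n) → ℝ} {c : ℝ}

/-- The density, with respect to Lebesgue measure on `u^⊥`, of the Gaussian surface area of the
Wulff shape of `a`. -/
noncomputable def surfaceDensity (C : ProperCone ℝ (EuclideanSpace ℝ (Fin n)))
    (ω : Set (EuclideanSpace ℝ (Fin n))) (u : EuclideanSpace ℝ (Fin n))
    (a f : EuclideanSpace ℝ (Fin n) → ℝ) (y : (ℝ ∙ u)ᗮ) : ℝ :=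
  ((2 * Real.pi) ^ ((n : ℝ) / 2))⁻¹ * (|⟪gaussNormal u (epiHeight C ω u a f 0) y, u⟫|⁻¹ *
    Real.exp (-‖graphMap u (epiHeight C ω u a f 0) y‖ ^ 2 / 2))

/-- The Gaussian surface area measure of the Wulff shape of `a`, as an image measure. -/
noncomputable def surfaceMeasure (C : ProperCone ℝ (EuclideanSpace ℝ (Fin n)))
    (ω : Set (EuclideanSpace ℝ (Fin n))) (u : EuclideanSpace ℝ (Fin n))
    (a f : EuclideanSpace ℝ (Fin n) → ℝ) : Measure (EuclideanSpace ℝ (Fin n)) :=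
  ((volume.restrict (regularSet C ω u a f)).withDensity fun y =>
    ENNReal.ofReal (surfaceDensity C ω u a f y)).map (gaussNormal u (epiHeight C ω u a f 0))

theorem surfaceDensity_nonneg (y : (ℝ ∙ u)ᗮ) : 0 ≤ surfaceDensity C ω u a f y := by
  have := Real.pi_pos
  unfold surfaceDensity
  positivity

namespace IsWulffData

theorem measurable_surfaceDensity (h : IsWulffData C ω u a f c) :
    Measurable (surfaceDensity C ω u a f) := by
  have hN := measurable_gaussNormal u (epiHeight C ω u a f 0)
  have hG := (continuous_graphMap u (h.continuous_epiHeight 0)).measurable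
  unfold surfaceDensity
  fun_prop

theorem le_abs_inner_gaussNormal (h : IsWulffData C ω u a f c) {y : (ℝ ∙ u)ᗮ}
    (hy : y ∈ regularSet C ω u a f) : c ≤ |⟪gaussNormal u (epiHeight C ω u a f 0) y, u⟫| := by
  have := h.le_neg_inner ((h.hasDerivAt_epiHeight hy.2).1 hy.1).1
  exact this.trans (neg_le_abs _)

/-- On regular points `|⟪N, u⟫| ≥ c`, and lifting to the graph only increases the norm, so a
Gaussian on `u^⊥` dominates the density. Finiteness makes `f` integrable on `ω`. -/
theorem isFiniteMeasure_surfaceMeasure (h : IsWulffData C ω u a f c) :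
    IsFiniteMeasure (surfaceMeasure C ω u a f) := by
  have : IsFiniteMeasure ((volume.restrict (regularSet C ω u a f)).withDensity fun y =>
      ENNReal.ofReal (surfaceDensity C ω u a f y)) := by
    refine isFiniteMeasure_withDensity_ofReal (Integrable.hasFiniteIntegral ?_)
    have hw : Integrable fun y : (ℝ ∙ u)ᗮ => ((2 * Real.pi) ^ ((n : ℝ) / 2))⁻¹ *
        (c⁻¹ * Real.exp (-‖y‖ ^ 2 / 2)) :=
      ((integrable_exp_neg_norm_sq_div_two _).const_mul _).const_mul _
    refine hw.restrict.mono' h.measurable_surfaceDensity.aestronglyMeasurable ?_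
    refine (ae_restrict_iff' h.measurableSet_regularSet).2 (Eventually.of_forall fun y hy => ?_)
    rw [Real.norm_of_nonneg (surfaceDensity_nonneg y), surfaceDensity]
    have h1 := h.le_abs_inner_gaussNormal hy
    have hpi := Real.pi_pos
    have hc := h.pos
    have h2 : ‖y‖ ^ 2 ≤ ‖graphMap u (epiHeight C ω u a f 0) y‖ ^ 2 := by
      rw [graphMap, norm_sq_add_smul h.norm_eq]
      exact le_add_of_nonneg_right (sq_nonneg _)
    gcongr
  unfold surfaceMeasure
  infer_instance

theorem surfaceMeasure_compl_eq_zero (h : IsWulffData C ω u a f c) :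
    surfaceMeasure C ω u a f ωᶜ = 0 := by
  have hN := measurable_gaussNormal u (epiHeight C ω u a f 0)
  have hm := h.isCompact.measurableSet.compl
  rw [surfaceMeasure, Measure.map_apply hN hm]
  refine withDensity_absolutelyContinuous _ _ ?_
  rw [Measure.restrict_apply (hN hm)]
  convert measure_empty (μ := volume)
  rw [eq_empty_iff_forall_notMem]
  rintro y ⟨hy, hreg⟩
  exact hy ((h.hasDerivAt_epiHeight hreg.2).1 hreg.1).1

theorem setIntegral_surfaceMeasure (h : IsWulffData C ω u a f c) :
    ∫ v in ω, f v ∂(surfaceMeasure C ω u a f) = ((2 * Real.pi) ^ ((n : ℝ) / 2))⁻¹ *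
      ∫ y in regularSet C ω u a f,
        Real.exp (-‖graphMap u (epiHeight C ω u a f 0) y‖ ^ 2 / 2) *
          (ω.indicator f (gaussNormal u (epiHeight C ω u a f 0) y) /
            (-⟪gaussNormal u (epiHeight C ω u a f 0) y, u⟫)) := by
  have hN := measurable_gaussNormal u (epiHeight C ω u a f 0)
  have hfm := h.continuousOn_right.measurable_indicator h.isCompact.measurableSet
  rw [← integral_indicator h.isCompact.measurableSet, surfaceMeasure,
    integral_map hN.aemeasurable hfm.aestronglyMeasurable,
    integral_withDensity_eq_integral_toReal_smul h.measurable_surfaceDensity.ennreal_ofReal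
      (Eventually.of_forall fun _ => ENNReal.ofReal_lt_top), ← integral_const_mul]
  refine setIntegral_congr_fun h.measurableSet_regularSet fun y hy => ?_
  have hneg := h.neg_inner_pos ((h.hasDerivAt_epiHeight hy.2).1 hy.1).1
  rw [ENNReal.toReal_ofReal (surfaceDensity_nonneg y), surfaceDensity, smul_eq_mul, ← abs_neg,
    abs_of_pos hneg, div_eq_mul_inv]
  ring

end IsWulffData

/-- Up to an `ℋ^{n-1}`-null set, the inverse Gauss image of `η` is the graph over the regular points
whose Gauss normal lies in `η`; the area formula does the rest. -/
theorem isGaussianSurfaceAreaMeasure_surfaceMeasure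
    {K : Set (EuclideanSpace ℝ (Fin n))} (hωsub : ω ⊆ polarOmega (C : Set _))
    (hK : IsDetermined (C : Set (EuclideanSpace ℝ (Fin n))) ω K)
    (h : IsWulffData C ω u (supportFunBar K) f c) :
    IsGaussianSurfaceAreaMeasure (C : Set (EuclideanSpace ℝ (Fin n))) K
      (surfaceMeasure C ω u (supportFunBar K) f) := by
  refine ⟨measure_mono_null (compl_subset_compl.2 hωsub) h.surfaceMeasure_compl_eq_zero, ?_⟩
  intro η hη hηsub
  set φ := epiHeight C ω u (supportFunBar K) f 0 with hφ
  have hφc : Continuous φ := h.continuous_epiHeight 0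
  have hN := measurable_gaussNormal u φ
  have hKmem : ∀ (y : (ℝ ∙ u)ᗮ) (s : ℝ), (y : EuclideanSpace ℝ (Fin n)) + s • u ∈ K ↔ φ y ≤ s := by
    intro y s
    conv_lhs => rw [hK.2]
    rw [hφ, h.epiHeight_le_iff]
    simp only [mem_inter_iff, mem_iInter, mem_ofPred_eq, supportFunBar, zero_mul, add_zero,
      neg_neg]
    rfl
  obtain ⟨v₀, hv₀⟩ := h.nonempty
  have hCmem := add_smul_mem_iff_coneHeight_le h.mem_interior (h.inner_nonpos hv₀) (h.inner_neg hv₀)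
  have hu0 : u ≠ 0 := by
    intro h0
    have := h.norm_eq
    simp [h0] at this
  -- The truncated subtraction is genuine: `u ≠ 0` forces `n ≥ 1`.
  have hfin : n - 1 = Module.finrank ℝ (ℝ ∙ u)ᗮ := by
    have := finrank_orthogonal_add_one hu0
    rw [finrank_euclideanSpace_fin] at this
    omega
  have hgeo : ∀ (y : (ℝ ∙ u)ᗮ) (s : ℝ), (y : EuclideanSpace ℝ (Fin n)) + s • u ∈
      frontier K ∩ interior (C : Set (EuclideanSpace ℝ (Fin n))) ↔
        φ y = s ∧ coneHeight C u y < s := by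
    intro y s
    rw [mem_inter_iff, add_smul_mem_frontier_iff h.norm_eq hK.1.isClosed hφc hKmem,
      add_smul_mem_interior_iff h.norm_eq h.continuous_coneHeight hCmem]
  set R := regularSet C ω u (supportFunBar K) f with hR
  have hRm : MeasurableSet R := h.measurableSet_regularSet
  set A := R ∩ gaussNormal u φ ⁻¹' η with hA
  have hAm : MeasurableSet A := hRm.inter (hN hη)
  have hGK : ∀ z, graphMap u φ z ∈ K := fun z => (hKmem z _).2 le_rfl
  have hsub1 : graphMap u φ '' A ⊆
      inverseGaussImage (C : Set (EuclideanSpace ℝ (Fin n))) K η := by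
    rintro _ ⟨y, ⟨hy, hyη⟩, rfl⟩
    refine ⟨(hgeo y _).2 ⟨rfl, hy.1⟩, _, hyη, ?_⟩
    rw [((h.hasDerivAt_epiHeight hy.2).1 hy.1).2.2.1, supportFunBar, neg_neg]
  have hsub2 : inverseGaussImage (C : Set (EuclideanSpace ℝ (Fin n))) K η ⊆
      graphMap u φ '' A ∪ graphMap u φ '' {y | ¬ DifferentiableAt ℝ φ y} := by
    rintro x ⟨hx, v, hv, hxv⟩
    rw [exists_eq_add_smul h.norm_eq x] at hx
    set y := (ℝ ∙ u)ᗮ.orthogonalProjectionOnto x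
    obtain ⟨hs, hlt⟩ := (hgeo _ _).1 hx
    have hxy : graphMap u φ y = x := by
      rw [graphMap, hs, ← exists_eq_add_smul h.norm_eq x]
    by_cases hd : DifferentiableAt ℝ φ y
    · refine Or.inl ⟨y, ⟨⟨hlt.trans_eq hs.symm, hd⟩, ?_⟩, hxy⟩
      have hvΩ := hηsub hv
      have hvn : ‖v‖ = 1 := by simpa using hvΩ.2
      -- Here `v ∈ η` need not lie in `ω`, so `⟪v, u⟫ < 0` comes from the compact set `{v}`.
      obtain ⟨c', hc', hcv⟩ := exists_inner_le_neg_mul_norm (singleton_subset_iff.2 hvΩ)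
        isCompact_singleton
      have huv := hcv v rfl u (interior_subset h.mem_interior)
      rw [h.norm_eq, real_inner_comm] at huv
      have := (eq_gaussNormal h.norm_eq hvn (by linarith) hd fun z => by
        rw [inner_sub_right, hxy, real_inner_comm, real_inner_comm x v, hxv]
        linarith [inner_le_supportFun hK.1 (polarOmega_subset_polarCone hvΩ) (hGK z)]).2
      rw [mem_preimage, ← this]
      exact hv
    · exact Or.inr ⟨y, hd, hxy⟩
  obtain ⟨k, hk⟩ := h.exists_lipschitzWith_epiHeight
  have hnull : μHE[Module.finrank ℝ (ℝ ∙ u)ᗮ]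
      (graphMap u φ '' {y | ¬ DifferentiableAt ℝ φ y}) = 0 :=
    euclideanHausdorffMeasure_graphMap_null h.norm_eq (hk 0) h.ae_differentiableAt
  have hae : inverseGaussImage (C : Set (EuclideanSpace ℝ (Fin n))) K η
      =ᵐ[μHE[Module.finrank ℝ (ℝ ∙ u)ᗮ]] graphMap u φ '' A := by
    refine (ae_le_set.2 (measure_mono_null ?_ hnull)).antisymm hsub1.eventuallyLE
    exact sdiff_subset_iff.2 hsub2
  rw [gaussianSurfaceArea, hfin, setLIntegral_congr hae,
    setLIntegral_graphMap h.norm_eq hφc hN hAm h.pos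
      (fun y hy => h.norm_eq_one _ ((h.hasDerivAt_epiHeight hy.1.2).1 hy.1.1).1)
      (fun y hy => h.le_abs_inner_gaussNormal hy.1)
      (fun y hy z _ => ((h.hasDerivAt_epiHeight hy.1.2).1 hy.1.1).2.1 z) (by fun_prop),
    surfaceMeasure, Measure.map_apply hN hη, withDensity_apply _ (hN hη),
    Measure.restrict_restrict (hN hη), inter_comm, ← hR, ← hA,
    ← lintegral_const_mul' _ _ ENNReal.ofReal_ne_top]
  refine lintegral_congr fun y => ?_
  have hpi := Real.pi_pos
  rw [← ENNReal.ofReal_mul (by positivity), ← ENNReal.ofReal_mul (by positivity)]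
  rfl

end SurfaceMeasure

/-! ### Co-volume by slices and the choice of `u` -/

section Covolume

variable {n : ℕ} {C : ProperCone ℝ (EuclideanSpace ℝ (Fin n))} {ω : Set (EuclideanSpace ℝ (Fin n))}
  {u : EuclideanSpace ℝ (Fin n)} {a f : EuclideanSpace ℝ (Fin n) → ℝ} {c : ℝ}

theorem isClosed_wulffShape {C : Set (EuclideanSpace ℝ (Fin n))} (hC : IsClosed C)
    (g : EuclideanSpace ℝ (Fin n) → ℝ) : IsClosed (wulffShape C ω g) :=
  hC.inter <| isClosed_iInter fun v => isClosed_iInter fun _ =>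
    isClosed_le (by fun_prop) continuous_const

theorem IsWulffData.gaussianCovolume_wulffShape (h : IsWulffData C ω u a f c) (t : ℝ) :
    gaussianCovolume (C : Set (EuclideanSpace ℝ (Fin n)))
        (wulffShape (C : Set (EuclideanSpace ℝ (Fin n))) ω fun v => a v + t * f v) =
      ((2 * Real.pi) ^ ((n : ℝ) / 2))⁻¹ * ∫ y : (ℝ ∙ u)ᗮ, Real.exp (-‖y‖ ^ 2 / 2) *
        ∫ s in coneHeight C u y..epiHeight C ω u a f t y, Real.exp (-s ^ 2 / 2) := by
  obtain ⟨v, hv⟩ := h.nonempty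
  rw [gaussianCovolume, setIntegral_exp_between_graphs h.norm_eq
    (φ₂ := epiHeight C ω u a f t) (C.isClosed.measurableSet.diff (isClosed_wulffShape C.isClosed _).measurableSet)
    (fun y => le_max_left _ _)]
  intro y s
  have h1 := add_smul_mem_iff_coneHeight_le h.mem_interior (h.inner_nonpos hv) (h.inner_neg hv) y s
  have h2 : (y : EuclideanSpace ℝ (Fin n)) + s • u ∈
      wulffShape (C : Set (EuclideanSpace ℝ (Fin n))) ω (fun v => a v + t * f v) ↔
        epiHeight C ω u a f t y ≤ s := by
    rw [h.epiHeight_le_iff, wulffShape]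
    simp only [mem_inter_iff, mem_iInter, mem_ofPred_eq]
    rfl
  rw [Set.mem_sdiff, h2, not_le]
  exact and_congr_left' h1

theorem exists_isWulffData (hCint : (interior (C : Set (EuclideanSpace ℝ (Fin n)))).Nonempty)
    (hωsub : ω ⊆ polarOmega (C : Set (EuclideanSpace ℝ (Fin n)))) (hωne : ω.Nonempty)
    (hω : IsCompact ω) {K : Set (EuclideanSpace ℝ (Fin n))}
    (hK : IsCPseudoCone (C : Set (EuclideanSpace ℝ (Fin n))) K) (hf : ContinuousOn f ω) :
    ∃ u c, IsWulffData C ω u (supportFunBar K) f c := by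
  obtain ⟨c, hc, hcω⟩ := exists_inner_le_neg_mul_norm hωsub hω
  have hone : ∀ v ∈ ω, ‖v‖ = 1 := fun v hv => by simpa using (hωsub hv).2
  obtain ⟨x, hx⟩ := hCint
  -- Were the origin interior, `C` would be the whole space and contain `v`, contradicting `⟪v, v⟫ ≤
  -- -c ‖v‖`.
  have hx0 : x ≠ 0 := by
    rintro rfl
    obtain ⟨v, hv⟩ := hωne
    obtain ⟨k, hk⟩ := exists_forall_add_smul_mem hx
    have h1 := hk v
    rw [smul_zero, add_zero] at h1
    have h2 := hcω v hv v h1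
    rw [real_inner_self_eq_norm_sq, hone v hv] at h2
    linarith
  have hxn : 0 < ‖x‖ := norm_pos_iff.2 hx0
  obtain ⟨m, hm, hmω⟩ := exists_pos_le_supportFunBar hK hωsub hω
  refine ⟨‖x‖⁻¹ • x, c, ?_, ?_, hω, hωne, hone, hc, hcω, fun v hv => hm.trans_le (hmω v hv),
    continuousOn_supportFunBar hK hωsub hω, hf⟩
  · refine mem_interior.2 ⟨(fun z => ‖x‖ • z) ⁻¹' interior (C : Set _), ?_,
      isOpen_interior.preimage (by fun_prop), ?_⟩
    · intro z hz
      have := C.smul_mem (interior_subset hz : ‖x‖ • z ∈ C) (inv_nonneg.2 hxn.le)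
      rwa [smul_smul, inv_mul_cancel₀ hxn.ne', one_smul] at this
    · rw [mem_preimage, smul_smul, mul_inv_cancel₀ hxn.ne', one_smul]
      exact hx
  · rw [norm_smul, norm_inv, norm_norm, inv_mul_cancel₀ hxn.ne']

end Covolume

end PseudoCone

/-! ### The variational formula -/

theorem lemma3p3 {n : ℕ}
    -- `C` is a closed convex cone of dimension `n` which is pointed: `C ∩ (-C) = {o}`
    (C : ProperCone ℝ (EuclideanSpace ℝ (Fin n)))
    (hCint : (interior (C : Set (EuclideanSpace ℝ (Fin n)))).Nonempty)
    (hCpointed : ∀ x ∈ C, -x ∈ C → x = 0)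
    (ω : Set (EuclideanSpace ℝ (Fin n)))
    (hωsub : ω ⊆ PseudoCone.polarOmega (C : Set (EuclideanSpace ℝ (Fin n))))
    (hωne : ω.Nonempty) (hωcpt : IsCompact ω)
    (K : Set (EuclideanSpace ℝ (Fin n)))
    (hK : PseudoCone.IsDetermined (C : Set (EuclideanSpace ℝ (Fin n))) ω K)
    (f : EuclideanSpace ℝ (Fin n) → ℝ) (hf : ContinuousOn f ω) :
    -- the functions whose Wulff shapes are taken are positive on `ω` for small `t`
    (∀ᶠ t in 𝓝 (0 : ℝ), ∀ v ∈ ω, 0 < PseudoCone.supportFunBar K v + t * f v) ∧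
    ∃ S : Measure (EuclideanSpace ℝ (Fin n)),
      PseudoCone.IsGaussianSurfaceAreaMeasure (C : Set (EuclideanSpace ℝ (Fin n))) K S ∧
      IntegrableOn f ω S ∧
      Tendsto
        (fun t : ℝ =>
          (PseudoCone.gaussianCovolume (C : Set (EuclideanSpace ℝ (Fin n)))
              (PseudoCone.wulffShape (C : Set (EuclideanSpace ℝ (Fin n))) ω
                (fun v => PseudoCone.supportFunBar K v + t * f v))
            - PseudoCone.gaussianCovolume (C : Set (EuclideanSpace ℝ (Fin n))) K) / t)
        (𝓝[≠] 0) (𝓝 (∫ v in ω, f v ∂S)) := by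

  obtain ⟨m, hm, hmω⟩ := PseudoCone.exists_pos_le_supportFunBar hK.1 hωsub hωcpt
  obtain ⟨M, hM⟩ := hωcpt.exists_bound_of_continuousOn hf
  obtain ⟨u, c, h⟩ := PseudoCone.exists_isWulffData hCint hωsub hωne hωcpt hK.1 hf
  have hfin := h.isFiniteMeasure_surfaceMeasure
  refine ⟨?_, PseudoCone.surfaceMeasure C ω u (PseudoCone.supportFunBar K) f,
    PseudoCone.isGaussianSurfaceAreaMeasure_surfaceMeasure hωsub hK h,
    hf.integrableOn_compact hωcpt, ?_⟩
  · have hlim : Tendsto (fun t : ℝ => |t| * M) (𝓝 0) (𝓝 (|0| * M)) :=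
      (by fun_prop : Continuous fun t : ℝ => |t| * M).tendsto 0
    rw [abs_zero, zero_mul] at hlim
    filter_upwards [hlim.eventually_lt_const hm] with t ht v hv
    have h1 := hmω v hv
    have h2 : |t * f v| ≤ |t| * M := by
      rw [abs_mul]
      exact mul_le_mul_of_nonneg_left (hM v hv) (abs_nonneg t)
    linarith [neg_abs_le (t * f v)]
  -- Being determined by `ω`, `K` is the Wulff shape at `t = 0`, so the quotient is the slope of a
  -- single function of `t`.
  · have hK0 : K = PseudoCone.wulffShape (C : Set (EuclideanSpace ℝ (Fin n))) ω
        (fun v => PseudoCone.supportFunBar K v + 0 * f v) := by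
      simp only [PseudoCone.wulffShape, PseudoCone.supportFunBar, zero_mul, add_zero, neg_neg]
      exact hK.2
    have hKcov := h.gaussianCovolume_wulffShape 0
    rw [← hK0] at hKcov
    rw [hKcov, h.setIntegral_surfaceMeasure]
    simp only [h.gaussianCovolume_wulffShape]
    have hslope := (h.hasDerivAt_integral.const_mul
      ((2 * Real.pi) ^ ((n : ℝ) / 2))⁻¹).tendsto_slope_zero
    refine hslope.congr fun t => ?_
    rw [zero_add, smul_eq_mul]
    exact (div_eq_inv_mul _ _).symm
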